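/- **Theorem 1.** There is an absolute constant $q_0$ such that the following holds. Let $q\ge q_0$ be an integer, let $d=\prod_{p\mid q}p$ be its kernel (the product of the distinct primes dividing $q$), and let $N$ be an integer with $$\max\bigl(d^{15},\,e^{900(\ln q)^{2/3}}\bigr)\le N\le \sqrt q .$$ Then for all integers $a,b,c$ with $(a,q)=1$, $$\Biggl|\sum_{\substack{c<n\le c+N\\ (n,q)=1}} e^{2\pi i(an^{*}+bn)/q}\Biggr| < N\exp\Bigl(-160^{-4}\,\frac{(\ln N)^3}{(\ln q)^2}\Bigr),$$ where the sum is over integers $n$, and $n^{*}$ denotes an integer with $nn^{*}\equiv 1\pmod q$. -/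

import Mathlib

/-- The kernel `∏_{p ∣ q} p` of `q`: the product of the distinct prime divisors of `q`. -/
def kernel (q : ℕ) : ℕ := ∏ p ∈ q.primeFactors, p

/-- `e_q(v) = exp(2πiv/q)` for an integer `v`. -/
noncomputable def eMod (q : ℕ) (v : ℤ) : ℂ :=
  Complex.exp (2 * (Real.pi : ℂ) * Complex.I * (v : ℂ) / (q : ℂ))

/-- A representative `n*` of the inverse of `n` modulo `q` (meaningful for `n` coprime to `q`). -/
def invMod (q : ℕ) (n : ℤ) : ℤ := (((n : ZMod q)⁻¹).val : ℤ)

/-- The short Kloosterman sum: the sum of `e_q(a n* + b n)` over the integers `c < n ≤ c + N`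
coprime to `q`. -/
noncomputable def kloostermanSum (q N : ℕ) (a b c : ℤ) : ℂ :=
  ∑ n ∈ (Finset.Ioc c (c + (N : ℤ))).filter (fun n : ℤ => Int.gcd n (q : ℤ) = 1),
    eMod q (a * invMod q n + b * n)

/-!
The sum is estimated by Vinogradov's method. Write `R ≈ 3 log q / log N`, and choose a modulus `D`,
with `q ∣ D ^ R` and `D ^ R ≤ d ^ R q` where `d` is the kernel of `q` (`exists_root_modulus`). Since
`D` is nilpotent modulo `q`, the inverse of `n + D z` is the polynomial
`∑ j < R, (-1) ^ j (n*) ^ (j + 1) D ^ j z ^ j` in `z` modulo `q`, so averaging over the shifts `n ↦ n + D x y`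
with `x, y < P` reduces the Kloosterman sum to bilinear sums `∑ x, ∑ y, ∏ j, ζ j ^ ((x y) ^ j)`
(`kloostermanSum_le_of_bilinear`). For `j ≥ 2`, the root of unity `ζ j` has exact order
`q / gcd (q, D ^ j)`, which lies between `q / D ^ j` and `q ^ (1 - j / R)`.

Two applications of Hölder's inequality bound a high power of such a bilinear sum by the square of
the Vinogradov mean value `J` and by a product over `j` of the sums `∑ μ, |∑ h, ζ j ^ (h μ)| ^ 2`
over boxes (`bilinear_bound`). Sharp boxes are majorized by Fejér weights, so the inner sums are
nonnegative, the outer ones can be completed to full periods, and orthogonality alone shows that the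
`j`-th factor saves a power of `N` whenever `j` lies in `[R / 2, 2 R / 3]`
(`sum_norm_sq_le_of_window`, `window_bounds`).

The mean value is bounded by Linnik's `p`-adic method, with one fixed prime `p` and `P = p ^ m`,
`m = 100 R` (`vinogradovJ_mul_le`). At each step, either the `r`-tuples of variables with distinct
residues modulo `p` dominate, by Newton's identities (`norm_sum_pow_le_elemSymm`), and are counted by
Linnik's lemma (`linnik_card_le`), or a single residue class does. In both cases one passes from `P`
to `P / p`, as the remaining variables lie in one residue class and the system is invariant under
translation and dilation. The step is optimal as long as the scale is at least `p ^ r`, so what is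
lost in the end is a factor `p ^ (r * r (r + 1) / 2)`, a small power of `P ^ (r ^ 2)`; it is smaller
than the saving from the coefficients. Working with a fixed prime makes the number of variables
linear in `m`, which the constant `160 ^ (-4)` leaves room for.

In the code the exponents `1, …, r`, with `r = R - 1`, are written `j + 1` with `j : Fin r`.
-/

open MeasureTheory Finset

/-! ### Counting coincidences by Fourier analysis on the torus -/

/-- The number of pairs of indices whose frequencies differ by `v`. -/
def diffCount {ι d : Type*} [Fintype ι] [Fintype d] (ν : ι → d → ℤ) (v : d → ℤ) : ℕ :=
  #{z : ι × ι | ν z.1 - ν z.2 = v}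

/-- The trigonometric polynomial `∑ i, e(⟨ν i, t⟩)` on the torus `(ℝ/ℤ)^d`. -/
noncomputable def trigSum {ι d : Type*} [Fintype ι] [Fintype d] (ν : ι → d → ℤ)
    (t : UnitAddTorus d) : ℂ :=
  ∑ i, UnitAddTorus.mFourier (ν i) t

/-- The Haar probability measure on the torus `(ℝ/ℤ)^d`. -/
noncomputable def torusMeasure (d : Type*) [Fintype d] : Measure (UnitAddTorus d) :=
  Measure.pi fun _ => AddCircle.haarAddCircle

instance (d : Type*) [Fintype d] : IsProbabilityMeasure (torusMeasure d) := by
  unfold torusMeasure; infer_instance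

section
variable {ι κ d : Type*} [Fintype ι] [Fintype κ] [Fintype d]

theorem integral_fourier_haar (n : ℤ) :
    ∫ t : AddCircle (1 : ℝ), fourier n t ∂AddCircle.haarAddCircle = if n = 0 then 1 else 0 := by
  have h := orthonormal_iff_ite.mp (orthonormal_fourier (T := (1 : ℝ))) 0 n
  rw [ContinuousMap.inner_toLp (𝕜 := ℂ) AddCircle.haarAddCircle (fourier 0) (fourier n)] at h
  simpa [eq_comm] using h

theorem integral_mFourier (n : d → ℤ) :
    ∫ t, UnitAddTorus.mFourier n t ∂torusMeasure d = if n = 0 then 1 else 0 := by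
  have h : ∀ t : UnitAddTorus d, UnitAddTorus.mFourier n t = ∏ i, fourier (n i) (t i) :=
    fun t => rfl
  simp_rw [h, torusMeasure]
  have := integral_fintype_prod_eq_prod (𝕜 := ℂ) (μ := fun _ : d => AddCircle.haarAddCircle)
    (fun i (x : AddCircle (1 : ℝ)) => (fourier (n i) x : ℂ))
  refine this.trans ?_
  simp_rw [integral_fourier_haar]
  split_ifs with h0
  · simp [h0]
  · obtain ⟨i, hi⟩ := Function.ne_iff.mp h0
    exact Finset.prod_eq_zero (mem_univ i) (by simpa using hi)

theorem continuous_trigSum (ν : ι → d → ℤ) : Continuous (trigSum ν) := by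
  unfold trigSum; fun_prop

theorem integrable_torus {E : Type*} [NormedAddCommGroup E] {f : UnitAddTorus d → E}
    (hf : Continuous f) : Integrable f (torusMeasure d) :=
  hf.integrable_of_hasCompactSupport (HasCompactSupport.of_compactSpace f)

theorem norm_sq_trigSum (ν : ι → d → ℤ) (t : UnitAddTorus d) :
    ((‖trigSum ν t‖ ^ 2 : ℝ) : ℂ)
      = ∑ z : ι × ι, UnitAddTorus.mFourier (ν z.1 - ν z.2) t := by
  rw [Complex.ofReal_pow, ← Complex.mul_conj', trigSum, map_sum, sum_mul_sum,
    ← Finset.univ_product_univ, sum_product]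
  simp_rw [← UnitAddTorus.mFourier_neg, sub_eq_add_neg, UnitAddTorus.mFourier_add]

theorem integral_norm_sq_mul_mFourier (ν : ι → d → ℤ) (v : d → ℤ) :
    ∫ t, ((‖trigSum ν t‖ ^ 2 : ℝ) : ℂ) * UnitAddTorus.mFourier (-v) t ∂torusMeasure d
      = diffCount ν v := by
  simp_rw [norm_sq_trigSum, Finset.sum_mul, ← UnitAddTorus.mFourier_add]
  rw [integral_finsetSum _ fun z _ => integrable_torus (by fun_prop)]
  simp_rw [integral_mFourier, ← sub_eq_add_neg, sub_eq_zero]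
  simp [diffCount]

theorem integral_norm_sq_trigSum (ν : ι → d → ℤ) :
    ∫ t, ‖trigSum ν t‖ ^ 2 ∂torusMeasure d = diffCount ν 0 := by
  have h := integral_norm_sq_mul_mFourier ν 0
  simp only [neg_zero, UnitAddTorus.mFourier_zero, ContinuousMap.one_apply, mul_one] at h
  rw [integral_complex_ofReal] at h
  exact_mod_cast h

/-- Any difference occurs at most as often as the zero difference: the counts are the Fourier
coefficients of the nonnegative function `|trigSum ν| ^ 2`. -/
theorem diffCount_le_zero (ν : ι → d → ℤ) (v : d → ℤ) : diffCount ν v ≤ diffCount ν 0 := by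
  have h := norm_integral_le_integral_norm (μ := torusMeasure d)
    (fun t => ((‖trigSum ν t‖ ^ 2 : ℝ) : ℂ) * UnitAddTorus.mFourier (-v) t)
  have h1 : ∀ t : UnitAddTorus d, ‖UnitAddTorus.mFourier (-v) t‖ ≤ 1 := fun t =>
    ((UnitAddTorus.mFourier (-v)).norm_coe_le_norm t).trans_eq UnitAddTorus.mFourier_norm
  rw [integral_norm_sq_mul_mFourier, Complex.norm_natCast] at h
  have h2 : (diffCount ν v : ℝ) ≤ diffCount ν 0 := by
    rw [← integral_norm_sq_trigSum]
    refine h.trans (integral_mono ?_ ?_ fun t => ?_)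
    · exact integrable_torus (by have := continuous_trigSum ν; fun_prop)
    · exact integrable_torus (by have := continuous_trigSum ν; fun_prop)
    · simp only [norm_mul, Complex.norm_real, norm_pow, norm_norm]
      exact mul_le_of_le_one_right (by positivity) (h1 t)
  exact_mod_cast h2

/-- The frequencies of the product of two trigonometric polynomials. -/
theorem trigSum_mul (ν : ι → d → ℤ) (ξ : κ → d → ℤ) (t : UnitAddTorus d) :
    trigSum ν t * trigSum ξ t = trigSum (fun z : ι × κ => ν z.1 + ξ z.2) t := by
  simp only [trigSum, sum_mul_sum, ← Finset.univ_product_univ, sum_product,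
    UnitAddTorus.mFourier_add]

theorem mFourier_sum {α : Type*} (s : Finset α) (ν : α → d → ℤ) (t : UnitAddTorus d) :
    UnitAddTorus.mFourier (∑ i ∈ s, ν i) t = ∏ i ∈ s, UnitAddTorus.mFourier (ν i) t := by
  classical
  induction s using Finset.induction_on with
  | empty => simp [UnitAddTorus.mFourier_zero]
  | insert a s ha ih => rw [sum_insert ha, prod_insert ha, UnitAddTorus.mFourier_add, ih]

theorem trigSum_pow (ν : ι → d → ℤ) (k : ℕ) (t : UnitAddTorus d) :
    trigSum ν t ^ k = trigSum (fun x : Fin k → ι => ∑ i, ν (x i)) t := by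
  simp only [trigSum, mFourier_sum]
  rw [Fintype.sum_pow]

end

/-! ### Newton's identities: distinct tuples and uniqueness from power sums -/

section
variable {α R : Type*} [Fintype α] [CommRing R]

/-- The `k`-th elementary symmetric function of a family `F`. -/
noncomputable def elemSymm (F : α → R) (k : ℕ) : R := ∑ S ∈ powersetCard k univ, ∏ a ∈ S, F a

@[simp] theorem elemSymm_zero (F : α → R) : elemSymm F 0 = 1 := by simp [elemSymm]

/-- Newton's identity with the term containing the first power sum split off. -/
theorem succ_mul_elemSymm (F : α → R) (k : ℕ) :
    ((k + 1 : ℕ) : R) * elemSymm F (k + 1) = elemSymm F k * ∑ a, F a +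
      ∑ l ∈ range k, (-1) ^ (k + l) * (elemSymm F l * ∑ a, F a ^ (k + 1 - l)) := by
  have h := congrArg (MvPolynomial.aeval F) (MvPolynomial.mul_esymm_eq_sum α R (k + 1))
  have he : ∀ n, MvPolynomial.aeval F (MvPolynomial.esymm α R n) = elemSymm F n := fun n => by
    simp [MvPolynomial.esymm, elemSymm]
  have hp : ∀ n, MvPolynomial.aeval F (MvPolynomial.psum α R n) = ∑ a, F a ^ n := fun n => by
    simp [MvPolynomial.psum]
  have hs : ∑ a ∈ antidiagonal (k + 1) with a.1 < k + 1,
      (-1 : R) ^ a.1 * elemSymm F a.1 * ∑ i, F i ^ a.2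
      = ∑ l ∈ range (k + 1), (-1) ^ l * elemSymm F l * ∑ a, F a ^ (k + 1 - l) := by
    rw [Finset.sum_filter, Finset.Nat.sum_antidiagonal_eq_sum_range_succ_mk,
      Finset.sum_range_succ, if_neg (by simp), add_zero]
    exact sum_congr rfl fun l hl => if_pos (mem_range.mp hl)
  simp only [map_mul, map_natCast, map_pow, map_neg, map_one, map_sum, he, hp] at h
  rw [h, hs, sum_range_succ, mul_add, add_comm]
  congr 1
  · have : (-1 : R) ^ (k + 1 + 1) * (-1) ^ k = 1 := by
      rw [← pow_add, Even.neg_one_pow ⟨k + 1, by ring⟩]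
    rw [← mul_assoc, ← mul_assoc, this]; simp
  · rw [mul_sum]
    exact sum_congr rfl fun l _ => by ring

/-- Power sums of exponents `1, …, r` determine the elementary symmetric functions, as long as
`1, …, r` are invertible. -/
theorem elemSymm_eq_of_power_sums {r : ℕ} (hr : ∀ k, k < r → IsUnit ((k + 1 : ℕ) : R))
    (u v : α → R) (h : ∀ j, j < r → ∑ i, u i ^ (j + 1) = ∑ i, v i ^ (j + 1)) :
    ∀ k, k ≤ r → elemSymm u k = elemSymm v k := by
  intro k
  induction k using Nat.strong_induction_on with
  | _ k ih =>
    intro hk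
    rcases k with _ | k
    · simp
    · refine (hr k hk).mul_left_cancel ?_
      have h1 := h 0 (by omega)
      simp only [zero_add, pow_one] at h1
      rw [succ_mul_elemSymm, succ_mul_elemSymm, ih k (by omega) (by omega), h1]
      congr 1
      refine sum_congr rfl fun l hl => ?_
      have hl := mem_range.mp hl
      have h2 := h (k - l) (by omega)
      rw [show k - l + 1 = k + 1 - l by omega] at h2
      rw [ih l (by omega) (by omega), h2]

/-- Vieta's formula: the elementary symmetric functions determine the monic polynomial with given
roots. -/
theorem prod_sub_eq_of_elemSymm (u v : α → R)
    (h : ∀ k, k ≤ Fintype.card α → elemSymm u k = elemSymm v k) (x : R) :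
    ∏ i, (x - u i) = ∏ i, (x - v i) := by
  have key : ∀ w : α → R, ∏ i, (x - w i)
      = ∑ j ∈ range (Fintype.card α + 1), (-1) ^ j * (elemSymm w j * x ^ (Fintype.card α - j)) := by
    intro w
    have h := congrArg (Polynomial.eval x)
      (Multiset.prod_X_sub_X_eq_sum_esymm (univ.val.map w))
    rw [Multiset.map_map] at h
    have h2 : (Multiset.map ((fun t => Polynomial.X - Polynomial.C t) ∘ w) univ.val).prod
        = ∏ i, (Polynomial.X - Polynomial.C (w i)) := rfl
    rw [h2, Polynomial.eval_prod, Polynomial.eval_finsetSum] at h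
    simpa [Finset.esymm_map_val, elemSymm, Polynomial.eval_finsetSum, Polynomial.eval_prod]
      using h
  rw [key u, key v]
  exact sum_congr rfl fun j hj => by rw [h j (by have := mem_range.mp hj; omega)]

theorem sum_embedding_prod [DecidableEq α] (F : α → R) (r : ℕ) :
    ∑ a : Fin r ↪ α, ∏ i, F (a i) = (r.factorial : R) * elemSymm F r := by
  have hmem : ∀ a ∈ (univ : Finset (Fin r ↪ α)), univ.map a ∈ powersetCard r (univ : Finset α) :=
    fun a _ => by simp [mem_powersetCard]
  rw [← sum_fiberwise_of_maps_to hmem, elemSymm, mul_sum]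
  refine sum_congr rfl fun S hS => ?_
  have hS := (mem_powersetCard.mp hS).2
  have hc : #{a : Fin r ↪ α | univ.map a = S} = r.factorial := by
    have e : (Fin r ≃ S) ≃ {a : Fin r ↪ α // univ.map a = S} :=
      { toFun := fun e => ⟨e.toEmbedding.trans (Function.Embedding.subtype _), by
          rw [← Finset.map_map, Finset.map_univ_equiv]; ext x; simp⟩
        invFun := fun a => Equiv.ofBijective
          (fun i => (⟨a.1 i, a.2.le (mem_map_of_mem _ (mem_univ i))⟩ : S))
          ⟨fun i j hij => a.1.injective (by simpa using hij), fun x => by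
            obtain ⟨i, -, hi⟩ := mem_map.mp (a.2.ge x.2)
            exact ⟨i, Subtype.ext hi⟩⟩
        left_inv := fun e => by ext i; rfl
        right_inv := fun a => by ext i; rfl }
    rw [← Fintype.card_subtype, ← Fintype.card_congr e,
      Fintype.card_equiv (Fintype.equivOfCardEq (by simp [hS])), Fintype.card_fin]
  rw [← hc, ← nsmul_eq_mul, ← sum_const]
  refine sum_congr rfl fun a ha => ?_
  rw [← (mem_filter.mp ha).2, prod_map]

end

/-- If a sum is large compared with the `ℓ²`-norm of its terms, its `r`-th power is controlled by
the contribution of the `r`-tuples of distinct terms. -/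
theorem norm_sum_pow_le_elemSymm {α : Type*} [Fintype α] (F : α → ℂ) (r : ℕ)
    {T : ℝ} (hT : 0 ≤ T) (hF : ∑ a, ‖F a‖ ^ 2 = T ^ 2) (hA : 4 * r * T ≤ ‖∑ a, F a‖) :
    ‖∑ a, F a‖ ^ r ≤ 2 * (r.factorial * ‖elemSymm F r‖) := by
  set A := ‖∑ a, F a‖ with hAdef
  have hA0 : 0 ≤ A := norm_nonneg _
  have hle : ∀ a, ‖F a‖ ≤ T := fun a => by
    refine abs_le_of_sq_le_sq' ?_ hT |>.2
    rw [← hF]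
    exact single_le_sum (f := fun a => ‖F a‖ ^ 2) (fun _ _ => by positivity) (mem_univ a)
  have hpow : ∀ n, ‖∑ a, F a ^ (n + 2)‖ ≤ T ^ (n + 2) := fun n => by
    calc ‖∑ a, F a ^ (n + 2)‖ ≤ ∑ a, ‖F a‖ ^ 2 * T ^ n := by
          refine (norm_sum_le _ _).trans (sum_le_sum fun a _ => ?_)
          rw [norm_pow, add_comm, pow_add]
          gcongr
          exact hle a
      _ = T ^ (n + 2) := by rw [← sum_mul, hF]; ring
  rcases Nat.eq_zero_or_pos r with rfl | hr
  · simp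
  have hr' : (1 : ℝ) ≤ r := by exact_mod_cast hr
  set B := A * (1 - 1 / (4 * r)) with hB
  have hB0 : 0 ≤ B := by
    apply mul_nonneg hA0
    rw [sub_nonneg, div_le_one (by positivity)]; linarith
  have hTB : B ≤ A - T := by
    have : T ≤ A / (4 * r) := by rw [le_div_iff₀ (by positivity)]; linarith
    have h2 : B = A - A / (4 * r) := by rw [hB]; ring
    linarith
  -- the error terms of Newton's identity stay below its main term, which grows by a factor at
  -- least `B` at each step
  have key : ∀ i, i ≤ r → ∑ l ∈ range i, ‖elemSymm F l‖ * T ^ (i - l) ≤ ‖elemSymm F i‖ ∧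
      B ^ i ≤ i.factorial * ‖elemSymm F i‖ := by
    intro i
    induction i with
    | zero => simp
    | succ i ih =>
      intro hi
      obtain ⟨h1, h2⟩ := ih (by omega)
      have hlow : B * ‖elemSymm F i‖ ≤ (i + 1 : ℕ) * ‖elemSymm F (i + 1)‖ := by
        have hN := succ_mul_elemSymm F i
        have h3 : ‖∑ l ∈ range i,
            (-1 : ℂ) ^ (i + l) * (elemSymm F l * ∑ a, F a ^ (i + 1 - l))‖
            ≤ T * ‖elemSymm F i‖ := by
          refine (norm_sum_le _ _).trans ?_
          refine le_trans ?_ (mul_le_mul_of_nonneg_left h1 hT)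
          rw [mul_sum]
          refine sum_le_sum fun l hl => ?_
          have hl := mem_range.mp hl
          have := hpow (i - 1 - l)
          rw [show i - 1 - l + 2 = i + 1 - l by omega] at this
          rw [norm_mul, norm_pow, norm_neg, norm_one, one_pow, one_mul, norm_mul]
          calc ‖elemSymm F l‖ * _ ≤ ‖elemSymm F l‖ * T ^ (i + 1 - l) := by gcongr
            _ = _ := by rw [show i + 1 - l = (i - l) + 1 by omega]; ring
        have h4 : ‖elemSymm F i * ∑ a, F a‖ ≤ (i + 1 : ℕ) * ‖elemSymm F (i + 1)‖
            + T * ‖elemSymm F i‖ := by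
          rw [eq_comm, ← eq_sub_iff_add_eq] at hN
          rw [hN]
          refine (norm_sub_le _ _).trans ?_
          rw [norm_mul, Complex.norm_natCast]
          gcongr
        rw [norm_mul] at h4
        nlinarith [norm_nonneg (elemSymm F i)]
      constructor
      · rw [sum_range_succ]
        have h5 : ∑ l ∈ range i, ‖elemSymm F l‖ * T ^ (i + 1 - l)
            = T * ∑ l ∈ range i, ‖elemSymm F l‖ * T ^ (i - l) := by
          rw [mul_sum]
          refine sum_congr rfl fun l hl => ?_
          have hl := mem_range.mp hl
          rw [show i + 1 - l = (i - l) + 1 by omega]; ring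
        rw [h5, show i + 1 - i = 1 by omega, pow_one]
        have h6 : T * ∑ l ∈ range i, ‖elemSymm F l‖ * T ^ (i - l) ≤ T * ‖elemSymm F i‖ :=
          mul_le_mul_of_nonneg_left h1 hT
        have hir : ((i + 1 : ℕ) : ℝ) ≤ r := by exact_mod_cast hi
        have h7 : 2 * T * r ≤ B := by
          have : B = A - A / (4 * r) := by rw [hB]; ring
          have h8 : A / (4 * r) ≤ A / 2 := by
            apply div_le_div_of_nonneg_left hA0 <;> linarith
          linarith
        have h9 : r * (2 * T * ‖elemSymm F i‖) ≤ r * ‖elemSymm F (i + 1)‖ := by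
          calc _ = (2 * T * r) * ‖elemSymm F i‖ := by ring
            _ ≤ B * ‖elemSymm F i‖ := by gcongr
            _ ≤ _ := hlow
            _ ≤ _ := by gcongr
        have := le_of_mul_le_mul_left h9 (by linarith)
        linarith
      · calc B ^ (i + 1) = B * B ^ i := by ring
          _ ≤ B * (i.factorial * ‖elemSymm F i‖) := by gcongr
          _ = i.factorial * (B * ‖elemSymm F i‖) := by ring
          _ ≤ i.factorial * ((i + 1 : ℕ) * ‖elemSymm F (i + 1)‖) := by gcongr
          _ = _ := by rw [Nat.factorial_succ]; push_cast; ring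
  -- Bernoulli's inequality bounds the total loss over the `r` steps
  have hb : (1 : ℝ) / 2 ≤ (1 - 1 / (4 * r)) ^ r := by
    have h := one_add_mul_le_pow (a := -(1 / (4 * r : ℝ))) (by
      have : 1 / (4 * r : ℝ) ≤ 1 := by rw [div_le_one (by positivity)]; linarith
      linarith) r
    have h2 : (r : ℝ) * -(1 / (4 * r)) = -(1 / 4) := by field_simp
    rw [h2] at h
    rw [sub_eq_add_neg]
    linarith
  have := (key r le_rfl).2
  rw [hB, mul_pow] at this
  have h10 : A ^ r * (1 / 2) ≤ A ^ r * (1 - 1 / (4 * r)) ^ r := by gcongr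
  linarith

/-! ### Linnik's lemma on systems of congruences -/

/-- Two tuples with the same power sums modulo `p ^ r`, one of which has distinct residues modulo
`p`, agree modulo `p ^ r` up to the choice of indices. -/
theorem exists_dvd_sub_of_power_sums {p r : ℕ} (hp : p.Prime) (hr : r < p) (x y : Fin r → ℤ)
    (hy : ∀ k l, (p : ℤ) ∣ y k - y l → k = l)
    (h : ∀ j < r, ((p ^ r : ℕ) : ℤ) ∣ ∑ i, x i ^ (j + 1) - ∑ i, y i ^ (j + 1)) (i : Fin r) :
    ∃ k, ((p ^ r : ℕ) : ℤ) ∣ x i - y k := by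
  have hpow : ∀ j < r, ∑ i, (x i : ZMod (p ^ r)) ^ (j + 1) = ∑ i, (y i : ZMod (p ^ r)) ^ (j + 1) := by
    intro j hj
    have := (ZMod.intCast_zmod_eq_zero_iff_dvd _ _).mpr (h j hj)
    push_cast at this
    exact sub_eq_zero.mp this
  have hunit : ∀ k, k < r → IsUnit ((k + 1 : ℕ) : ZMod (p ^ r)) := fun k hk => by
    rw [ZMod.isUnit_iff_coprime]
    refine Nat.Coprime.pow_right _ (Nat.Coprime.symm ?_)
    exact (Nat.Prime.coprime_iff_not_dvd hp).mpr fun hd => by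
      have := Nat.le_of_dvd (by omega) hd; omega
  have hprod := prod_sub_eq_of_elemSymm (fun i => (x i : ZMod (p ^ r))) (fun i => (y i : ZMod (p ^ r)))
    (by rw [Fintype.card_fin]; exact elemSymm_eq_of_power_sums hunit _ _ hpow) (x i : ZMod (p ^ r))
  rw [Finset.prod_eq_zero (mem_univ i) (by simp)] at hprod
  have hd : ((p ^ r : ℕ) : ℤ) ∣ ∏ k, (x i - y k) := by
    rw [← ZMod.intCast_zmod_eq_zero_iff_dvd]
    push_cast
    exact hprod.symm
  have hpi : Prime (p : ℤ) := Nat.prime_iff_prime_int.mp hp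
  have hp1 : (p : ℤ) ∣ ∏ k, (x i - y k) :=
    (Int.natCast_dvd_natCast.mpr (dvd_pow_self p (by have := i.2; omega))).trans hd
  obtain ⟨k, -, hk⟩ := (hpi.dvd_finsetProd_iff _).mp hp1
  refine ⟨k, ?_⟩
  rw [← Finset.mul_prod_erase _ _ (mem_univ k)] at hd
  refine IsCoprime.dvd_of_dvd_mul_right ?_ hd
  push_cast
  refine IsCoprime.pow_left (IsCoprime.prod_right fun l hl => ?_)
  rw [hpi.coprime_iff_not_dvd]
  intro hl'
  have : (p : ℤ) ∣ y k - y l := by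
    have := dvd_sub hl' hk
    rwa [sub_sub_sub_cancel_left] at this
  exact (ne_of_mem_erase hl) (hy k l this).symm

/-- The number of tuples with distinct residues modulo `p` and prescribed power sums
modulo `p ^ r`. -/
theorem card_tuples_power_sums_le {p r m : ℕ} (hp : p.Prime) (hr : r < p) (hm : r ≤ m) (a : ℤ)
    (S : Finset (Fin r → ℕ)) (hlt : ∀ x ∈ S, ∀ i, x i < p ^ m)
    (hinj : ∀ x ∈ S, ∀ k l, (p : ℤ) ∣ (x k : ℤ) - x l → k = l)
    (h : ∀ x ∈ S, ∀ y ∈ S, ∀ j < r, ((p ^ r : ℕ) : ℤ) ∣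
      ∑ i, ((x i : ℤ) - a) ^ (j + 1) - ∑ i, ((y i : ℤ) - a) ^ (j + 1)) :
    #S ≤ (r * p ^ (m - r)) ^ r := by
  rcases S.eq_empty_or_nonempty with rfl | ⟨y, hy⟩
  · simp
  have hex : ∀ x ∈ S, ∀ i, ∃ k, ((p ^ r : ℕ) : ℤ) ∣ (x i : ℤ) - y k := by
    intro x hx i
    obtain ⟨k, hk⟩ := exists_dvd_sub_of_power_sums hp hr (fun i => (x i : ℤ) - a)
      (fun i => (y i : ℤ) - a) (fun k l hkl => hinj y hy k l (by simpa using hkl)) (h x hx y hy) i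
    exact ⟨k, by simpa using hk⟩
  choose! κ hκ using hex
  have hpr : 0 < p ^ r := pow_pos hp.pos r
  have hcard : #(Fintype.piFinset fun _ : Fin r => (univ : Finset (Fin r)) ×ˢ range (p ^ (m - r)))
      = (r * p ^ (m - r)) ^ r := by
    simp [Fintype.card_piFinset]
  rw [← hcard]
  refine card_le_card_of_injOn (fun x i => (κ x i, x i / p ^ r)) (fun x hx => ?_) ?_
  · rw [mem_coe, Fintype.mem_piFinset]
    intro i
    rw [mem_product, mem_range]
    refine ⟨mem_univ _, ?_⟩
    rw [Nat.div_lt_iff_lt_mul hpr, ← pow_add, Nat.sub_add_cancel hm]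
    exact hlt x hx i
  · intro x hx x' hx' hxx
    funext i
    have hi := congrFun hxx i
    simp only [Prod.mk.injEq] at hi
    have hd := dvd_sub (hκ x hx i) (hκ x' hx' i)
    rw [hi.1, sub_sub_sub_cancel_right] at hd
    have hmod : x' i ≡ x i [MOD p ^ r] := (Nat.modEq_iff_dvd).mpr hd
    rw [← Nat.div_add_mod (x i) (p ^ r), ← Nat.div_add_mod (x' i) (p ^ r), hi.2, hmod]

/-- A residue modulo `p ^ j` has at most `p ^ (r - j)` lifts to a residue modulo `p ^ r`. -/
theorem card_range_filter_dvd_le {p r j : ℕ} (hp : 0 < p) (hj : j ≤ r) (c : ℤ) :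
    #((range (p ^ r)).filter fun z : ℕ => ((p ^ j : ℕ) : ℤ) ∣ (z : ℤ) - c) ≤ p ^ (r - j) := by
  rw [← card_range (p ^ (r - j))]
  refine card_le_card_of_injOn (fun z => z / p ^ j) (fun z hz => ?_) ?_
  · simp only [coe_range, Set.mem_Iio]
    rw [Nat.div_lt_iff_lt_mul (pow_pos hp j), ← pow_add, Nat.sub_add_cancel hj]
    exact mem_range.mp (mem_filter.mp hz).1
  · intro z hz z' hz' hzz
    have hd := dvd_sub (mem_filter.mp hz).2 (mem_filter.mp hz').2
    rw [sub_sub_sub_cancel_right] at hd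
    have hmod : z' ≡ z [MOD p ^ j] := (Nat.modEq_iff_dvd).mpr hd
    simp only at hzz
    rw [← Nat.div_add_mod z (p ^ j), ← Nat.div_add_mod z' (p ^ j), hzz, hmod]

/-- **Linnik's lemma**: the number of tuples in `[0, p ^ m)` with distinct residues modulo `p` whose
`j`-th power sum is prescribed modulo `p ^ j` for `1 ≤ j ≤ r`. -/
theorem linnik_card_le {p r m : ℕ} (hp : p.Prime) (hr : r < p) (hm : r ≤ m) (a : ℤ) (c : ℕ → ℤ)
    (S : Finset (Fin r → ℕ)) (hlt : ∀ x ∈ S, ∀ i, x i < p ^ m)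
    (hinj : ∀ x ∈ S, ∀ k l, (p : ℤ) ∣ (x k : ℤ) - x l → k = l)
    (h : ∀ x ∈ S, ∀ j < r, ((p ^ (j + 1) : ℕ) : ℤ) ∣ ∑ i, ((x i : ℤ) - a) ^ (j + 1) - c j) :
    #S ≤ (r * p ^ (m - r)) ^ r * p ^ (∑ j ∈ range r, (r - (j + 1))) := by
  have hpr : (0 : ℤ) < ((p ^ r : ℕ) : ℤ) := by exact_mod_cast pow_pos hp.pos r
  set g : (Fin r → ℕ) → Fin r → ℕ := fun x j =>
    ((∑ i, ((x i : ℤ) - a) ^ ((j : ℕ) + 1)) % ((p ^ r : ℕ) : ℤ)).toNat with hg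
  have hgz : ∀ x j, ((g x j : ℕ) : ℤ)
      = (∑ i, ((x i : ℤ) - a) ^ ((j : ℕ) + 1)) % ((p ^ r : ℕ) : ℤ) := fun x j =>
    Int.toNat_of_nonneg (Int.emod_nonneg _ hpr.ne')
  set T := Fintype.piFinset fun j : Fin r =>
    (range (p ^ r)).filter fun z : ℕ => ((p ^ ((j : ℕ) + 1) : ℕ) : ℤ) ∣ (z : ℤ) - c j with hT
  have hTcard : #T ≤ p ^ (∑ j ∈ range r, (r - (j + 1))) := by
    rw [hT, Fintype.card_piFinset, ← Finset.prod_pow_eq_pow_sum,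
      ← Fin.prod_univ_eq_prod_range (fun j => p ^ (r - (j + 1))) r]
    exact prod_le_prod' fun j _ => card_range_filter_dvd_le hp.pos j.2 _
  refine (card_le_mul_card_image_of_maps_to (f := g) (t := T) (fun x hx => ?_) _
    fun z _ => ?_).trans (Nat.mul_le_mul_left _ hTcard)
  · rw [hT, Fintype.mem_piFinset]
    intro j
    rw [mem_filter, mem_range]
    constructor
    · have : ((g x j : ℕ) : ℤ) < ((p ^ r : ℕ) : ℤ) := by
        rw [hgz]; exact Int.emod_lt_of_pos _ hpr
      exact_mod_cast this
    · have h1 : ((p ^ ((j : ℕ) + 1) : ℕ) : ℤ) ∣ (g x j : ℤ) - ∑ i, ((x i : ℤ) - a) ^ ((j : ℕ) + 1) := by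
        rw [hgz]
        refine (Int.natCast_dvd_natCast.mpr (pow_dvd_pow p j.2)).trans ?_
        rw [dvd_sub_comm]
        exact Int.dvd_self_sub_emod
      have := dvd_add h1 (h x hx j j.2)
      rwa [sub_add_sub_cancel] at this
  · refine card_tuples_power_sums_le hp hr hm a _ (fun x hx => hlt x (mem_filter.mp hx).1)
      (fun x hx => hinj x (mem_filter.mp hx).1) fun x hx y hy j hj => ?_
    have hx := congrArg (fun f => ((f ⟨j, hj⟩ : ℕ) : ℤ)) (mem_filter.mp hx).2
    have hy := congrArg (fun f => ((f ⟨j, hj⟩ : ℕ) : ℤ)) (mem_filter.mp hy).2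
    simp only [hgz] at hx hy
    exact (Int.ModEq.dvd (show _ ≡ _ [ZMOD _] from hy.trans hx.symm))

/-! ### Vinogradov's mean value -/

/-- The frequency vector `(x, x², …, x^r)` on the moment curve. -/
def momentVec (r : ℕ) (x : ℤ) : Fin r → ℤ := fun j => x ^ ((j : ℕ) + 1)

/-- Vinogradov's mean value: the number of solutions of `∑ xᵢ ^ j = ∑ yᵢ ^ j`, `1 ≤ j ≤ r`, with
`k` variables on each side, all in `[0, P)`. -/
def vinogradovJ (r k P : ℕ) : ℕ :=
  diffCount (fun x : Fin k → Fin P => ∑ i, momentVec r ((x i : ℕ) : ℤ)) 0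

theorem sum_pow_sub_eq {ι : Type*} [Fintype ι] {r : ℕ} (x y : ι → ℤ) (a : ℤ)
    (h : ∀ j < r, ∑ i, x i ^ (j + 1) = ∑ i, y i ^ (j + 1)) {j : ℕ} (hj : j < r) :
    ∑ i, (x i - a) ^ (j + 1) = ∑ i, (y i - a) ^ (j + 1) := by
  simp_rw [sub_eq_add_neg, add_pow]
  rw [sum_comm, sum_comm (s := univ (α := ι))]
  refine sum_congr rfl fun l hl => ?_
  rw [← sum_mul, ← sum_mul, ← sum_mul, ← sum_mul]
  rcases l with _ | l
  · simp
  · rw [h l (by have := mem_range.mp hl; omega)]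

/-- The mean value over a residue class modulo `p` is at most the mean value over an initial
segment, by translation and dilation. -/
theorem diffCount_class_le (r k n p : ℕ) (hp : 0 < p) (a : ℤ) :
    diffCount (fun x : Fin k → Fin n => ∑ i, momentVec r (a + p * ((x i : ℕ) : ℤ))) 0
      ≤ vinogradovJ r k n := by
  refine card_le_card fun z hz => ?_
  simp only [mem_filter, mem_univ, true_and, sub_eq_zero] at hz ⊢
  funext j
  have h := sum_pow_sub_eq (r := r) (fun i => a + p * ((z.1 i : ℕ) : ℤ))
    (fun i => a + p * ((z.2 i : ℕ) : ℤ)) a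
    (fun j hj => by
      have := congrFun hz ⟨j, hj⟩
      simpa [momentVec] using this) j.2
  simp only [add_sub_cancel_left, mul_pow, ← mul_sum] at h
  have hp' : ((p : ℤ) ^ ((j : ℕ) + 1)) ≠ 0 := by positivity
  simpa [momentVec] using mul_left_cancel₀ hp' h

/-- The frequencies of the `r`-tuples in `[0, p n)` with distinct residues modulo `p`. Such a tuple is
encoded by its tuple of residues, an embedding, and its tuple of quotients by `p`. -/
def distinctVec (r p n : ℕ) (o : (Fin r ↪ Fin p) × (Fin r → Fin n)) : Fin r → ℤ :=
  ∑ i, momentVec r (((o.1 i : ℕ) + p * (o.2 i : ℕ) : ℕ) : ℤ)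

/-- For a given second tuple, Linnik's lemma bounds the number of first tuples whose power sums
about `a` agree with its own modulo `p`, `p ^ 2`, …, `p ^ r`. -/
theorem card_distinct_pairs_le {p r m : ℕ} (hp : p.Prime) (hr : r < p) (hm : r ≤ m) (hm1 : 1 ≤ m)
    (a : ℤ) :
    #{o : ((Fin r ↪ Fin p) × (Fin r → Fin (p ^ (m - 1)))) ×
        ((Fin r ↪ Fin p) × (Fin r → Fin (p ^ (m - 1)))) |
      ∀ j < r, ((p ^ (j + 1) : ℕ) : ℤ) ∣
        ∑ i, ((((o.1.1 i : ℕ) + p * (o.1.2 i : ℕ) : ℕ) : ℤ) - a) ^ (j + 1) -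
        ∑ i, ((((o.2.1 i : ℕ) + p * (o.2.2 i : ℕ) : ℕ) : ℤ) - a) ^ (j + 1)}
      ≤ ((r * p ^ (m - r)) ^ r * p ^ (∑ j ∈ range r, (r - (j + 1)))) * (p ^ m) ^ r := by
  have hcard : #(univ : Finset ((Fin r ↪ Fin p) × (Fin r → Fin (p ^ (m - 1))))) ≤ (p ^ m) ^ r := by
    rw [card_univ, Fintype.card_prod, Fintype.card_embedding_eq, Fintype.card_fin, Fintype.card_fin,
      Fintype.card_fun, Fintype.card_fin, Fintype.card_fin]
    calc p.descFactorial r * (p ^ (m - 1)) ^ r ≤ p ^ r * (p ^ (m - 1)) ^ r := by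
          gcongr; exact Nat.descFactorial_le_pow p r
      _ = (p ^ m) ^ r := by
          rw [← mul_pow, ← pow_succ', Nat.sub_add_cancel hm1]
  refine (card_le_mul_card_image_of_maps_to (f := Prod.snd) (t := univ) (fun _ _ => mem_univ _) _
    fun o' _ => ?_).trans (Nat.mul_le_mul_left _ hcard)
  set φ : ((Fin r ↪ Fin p) × (Fin r → Fin (p ^ (m - 1)))) ×
      ((Fin r ↪ Fin p) × (Fin r → Fin (p ^ (m - 1)))) → Fin r → ℕ :=
    fun o i => (o.1.1 i : ℕ) + p * (o.1.2 i : ℕ) with hφ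
  rw [← card_image_of_injOn (f := φ)]
  · refine linnik_card_le hp hr hm a
      (fun j => ∑ i, ((((o'.1 i : ℕ) + p * (o'.2 i : ℕ) : ℕ) : ℤ) - a) ^ (j + 1)) _ ?_ ?_ ?_
    · intro x hx i
      obtain ⟨o, -, rfl⟩ := mem_image.mp hx
      have h1 := (o.1.1 i).2
      have h2 : ((o.1.2 i : ℕ) + 1) ≤ p ^ (m - 1) := (o.1.2 i).2
      calc φ o i < p * ((o.1.2 i : ℕ) + 1) := by simp only [hφ]; linarith
        _ ≤ p * p ^ (m - 1) := Nat.mul_le_mul_left _ h2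
        _ = p ^ m := by rw [← pow_succ', Nat.sub_add_cancel hm1]
    · intro x hx k l hkl
      obtain ⟨o, -, rfl⟩ := mem_image.mp hx
      have hmod : φ o l ≡ φ o k [MOD p] := (Nat.modEq_iff_dvd).mpr hkl
      have : (o.1.1 l : ℕ) = o.1.1 k := by
        have := hmod
        simp only [hφ, Nat.ModEq, Nat.add_mul_mod_self_left] at this
        rwa [Nat.mod_eq_of_lt (o.1.1 l).2, Nat.mod_eq_of_lt (o.1.1 k).2] at this
      exact (o.1.1.injective (Fin.ext this)).symm
    · intro x hx j hj
      obtain ⟨o, ho, rfl⟩ := mem_image.mp hx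
      obtain ⟨ho, ho'⟩ := mem_filter.mp ho
      have := (mem_filter.mp ho).2 j hj
      rw [← ho']
      exact this
  · intro o ho o₂ ho₂ h
    have e : o.2 = o₂.2 := (mem_filter.mp ho).2.trans (mem_filter.mp ho₂).2.symm
    have hi : ∀ i, (o.1.1 i : ℕ) = o₂.1.1 i ∧ (o.1.2 i : ℕ) = o₂.1.2 i := fun i => by
      have h := congrFun h i
      simp only [hφ] at h
      have h1 : (o.1.1 i : ℕ) = o₂.1.1 i := by
        have := congrArg (· % p) h
        simp only [Nat.add_mul_mod_self_left] at this
        rwa [Nat.mod_eq_of_lt (o.1.1 i).2, Nat.mod_eq_of_lt (o₂.1.1 i).2] at this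
      refine ⟨h1, ?_⟩
      rw [h1] at h
      exact Nat.eq_of_mul_eq_mul_left hp.pos (Nat.add_left_cancel h)
    refine Prod.ext (Prod.ext ?_ ?_) e
    · ext i; exact (hi i).1
    · funext i; exact Fin.ext (hi i).2

/-- The system with `r` variables having distinct residues modulo `p` and the remaining `k`
variables in a fixed residue class: for each choice of the former, the latter solve an
inhomogeneous system at scale `p ^ (m - 1)`. -/
theorem diffCount_distinct_le {p r m : ℕ} (k : ℕ) (hp : p.Prime) (hr : r < p) (hm : r ≤ m)
    (hm1 : 1 ≤ m) (a : ℤ) :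
    diffCount (fun z : ((Fin r ↪ Fin p) × (Fin r → Fin (p ^ (m - 1)))) ×
        (Fin k → Fin (p ^ (m - 1))) => distinctVec r p (p ^ (m - 1)) z.1 +
          ∑ i, momentVec r (a + p * ((z.2 i : ℕ) : ℤ))) 0
      ≤ vinogradovJ r k (p ^ (m - 1)) *
        (((r * p ^ (m - r)) ^ r * p ^ (∑ j ∈ range r, (r - (j + 1)))) * (p ^ m) ^ r) := by
  set n := p ^ (m - 1) with hn
  refine (card_le_mul_card_image_of_maps_to (f := fun z => (z.1.1, z.2.1)) (fun z hz => ?_) _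
    fun o ho => ?_).trans (Nat.mul_le_mul_left _ (card_distinct_pairs_le hp hr hm hm1 a))
  all_goals
    have key : ∀ z : ((((Fin r ↪ Fin p) × (Fin r → Fin n)) × (Fin k → Fin n)) ×
        (((Fin r ↪ Fin p) × (Fin r → Fin n)) × (Fin k → Fin n))),
        (distinctVec r p n z.1.1 + ∑ i, momentVec r (a + p * ((z.1.2 i : ℕ) : ℤ))) -
        (distinctVec r p n z.2.1 + ∑ i, momentVec r (a + p * ((z.2.2 i : ℕ) : ℤ))) = 0 →
        ∀ j < r, ∑ i, ((((z.1.1.1 i : ℕ) + p * (z.1.1.2 i : ℕ) : ℕ) : ℤ) - a) ^ (j + 1) -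
          ∑ i, ((((z.2.1.1 i : ℕ) + p * (z.2.1.2 i : ℕ) : ℕ) : ℤ) - a) ^ (j + 1) =
          ((p ^ (j + 1) : ℕ) : ℤ) *
            (∑ i, ((z.2.2 i : ℕ) : ℤ) ^ (j + 1) - ∑ i, ((z.1.2 i : ℕ) : ℤ) ^ (j + 1)) := by
      intro z hz j hj
      have h := sum_pow_sub_eq (r := r) (ι := Fin r ⊕ Fin k)
        (Sum.elim (fun i => (((z.1.1.1 i : ℕ) + p * (z.1.1.2 i : ℕ) : ℕ) : ℤ))
          (fun i => a + p * ((z.1.2 i : ℕ) : ℤ)))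
        (Sum.elim (fun i => (((z.2.1.1 i : ℕ) + p * (z.2.1.2 i : ℕ) : ℕ) : ℤ))
          (fun i => a + p * ((z.2.2 i : ℕ) : ℤ))) a
        (fun j hj => by
          have := congrFun (sub_eq_zero.mp hz) ⟨j, hj⟩
          simpa [momentVec, distinctVec] using this) hj
      simp only [Fintype.sum_sum_type, Sum.elim_inl, Sum.elim_inr, add_sub_cancel_left, mul_pow,
        ← mul_sum] at h
      push_cast at h ⊢
      linear_combination h
  · simp only [mem_filter, mem_univ, true_and] at hz ⊢
    intro j hj
    rw [key z hz j hj]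
    exact dvd_mul_right _ _
  · set v : Fin r → ℤ := fun j =>
      (∑ i, ((((o.2.1 i : ℕ) + p * (o.2.2 i : ℕ) : ℕ) : ℤ) - a) ^ ((j : ℕ) + 1) -
        ∑ i, ((((o.1.1 i : ℕ) + p * (o.1.2 i : ℕ) : ℕ) : ℤ) - a) ^ ((j : ℕ) + 1)) /
          ((p ^ ((j : ℕ) + 1) : ℕ) : ℤ) with hv
    refine le_trans ?_ (diffCount_le_zero
      (fun x : Fin k → Fin n => ∑ i, momentVec r ((x i : ℕ) : ℤ)) v)
    refine card_le_card_of_injOn (fun z => (z.1.2, z.2.2)) (fun z hz => ?_) ?_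
    · obtain ⟨hz', rfl⟩ := mem_filter.mp hz
      have hz0 := (mem_filter.mp hz').2
      rw [mem_coe, mem_filter]
      refine ⟨mem_univ _, ?_⟩
      funext j
      have h := key z hz0 j j.2
      have hp0 : ((p ^ ((j : ℕ) + 1) : ℕ) : ℤ) ≠ 0 := by
        exact_mod_cast (pow_pos hp.pos _).ne'
      simp only [hv]
      rw [← neg_sub (∑ i, ((((z.1.1.1 i : ℕ) + p * (z.1.1.2 i : ℕ) : ℕ) : ℤ) - a) ^ ((j : ℕ) + 1)),
        h, ← mul_neg, Int.mul_ediv_cancel_left _ hp0]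
      simp [momentVec]
    · intro z hz z' hz' h
      have e := (mem_filter.mp hz).2.trans (mem_filter.mp hz').2.symm
      simp only [Prod.mk.injEq] at h e
      exact Prod.ext (Prod.ext e.1 h.1) (Prod.ext e.2 h.2)

theorem sum_pow_le_card_pow_mul {α : Type*} [Fintype α] (f : α → ℝ) (hf : ∀ a, 0 ≤ f a) {n : ℕ}
    (hn : 1 ≤ n) : (∑ a, f a) ^ n ≤ (Fintype.card α : ℝ) ^ (n - 1) * ∑ a, f a ^ n := by
  obtain ⟨n, rfl⟩ := Nat.exists_eq_add_of_le' hn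
  rcases isEmpty_or_nonempty α with h | h
  · simp
  have := pow_sum_div_card_le_sum_pow (s := (univ : Finset α)) (f := f) (fun a _ => hf a) n
  rw [div_le_iff₀ (by have := Fintype.card_pos (α := α); positivity)] at this
  simpa [mul_comm] using this

/-- Either the tuples of distinct terms or a single term dominates a power of a sum. -/
theorem norm_sum_pow_le_distinct_add {α : Type*} [Fintype α] [DecidableEq α] (F : α → ℂ) (r k : ℕ)
    (hk : 1 ≤ k) :
    ‖∑ a, F a‖ ^ (2 * (r + k)) ≤
      4 * (Fintype.card α : ℝ) ^ (2 * k - 1) *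
        ∑ a, ‖∑ o : Fin r ↪ α, ∏ i, F (o i)‖ ^ 2 * ‖F a‖ ^ (2 * k) +
      (4 * r : ℝ) ^ (2 * (r + k)) * (Fintype.card α : ℝ) ^ (r + k - 1) *
        ∑ a, ‖F a‖ ^ (2 * (r + k)) := by
  set T := Real.sqrt (∑ a, ‖F a‖ ^ 2) with hT
  have hT2 : ∑ a, ‖F a‖ ^ 2 = T ^ 2 := (Real.sq_sqrt (sum_nonneg fun _ _ => by positivity)).symm
  have hT0 : 0 ≤ T := Real.sqrt_nonneg _
  rcases le_total (4 * r * T) ‖∑ a, F a‖ with h | h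
  · have h1 := norm_sum_pow_le_elemSymm F r hT0 hT2 h
    have h2 : (r.factorial : ℝ) * ‖elemSymm F r‖ = ‖∑ o : Fin r ↪ α, ∏ i, F (o i)‖ := by
      rw [sum_embedding_prod, norm_mul, Complex.norm_natCast]
    rw [h2] at h1
    set E := ‖∑ o : Fin r ↪ α, ∏ i, F (o i)‖
    have h3 : ‖∑ a, F a‖ ^ (2 * k) ≤ (Fintype.card α : ℝ) ^ (2 * k - 1) * ∑ a, ‖F a‖ ^ (2 * k) :=
      (pow_le_pow_left₀ (norm_nonneg _) (norm_sum_le _ _) _).trans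
        (sum_pow_le_card_pow_mul _ (fun _ => norm_nonneg _) (by omega))
    refine le_add_of_le_of_nonneg ?_ (by positivity)
    calc ‖∑ a, F a‖ ^ (2 * (r + k)) = (‖∑ a, F a‖ ^ r) ^ 2 * ‖∑ a, F a‖ ^ (2 * k) := by ring
      _ ≤ (2 * E) ^ 2 * ((Fintype.card α : ℝ) ^ (2 * k - 1) * ∑ a, ‖F a‖ ^ (2 * k)) := by gcongr
      _ = _ := by rw [← mul_sum]; ring
  · refine le_add_of_nonneg_of_le (by positivity) ?_
    calc ‖∑ a, F a‖ ^ (2 * (r + k)) ≤ (4 * r * T) ^ (2 * (r + k)) := by gcongr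
      _ = (4 * r : ℝ) ^ (2 * (r + k)) * (∑ a, ‖F a‖ ^ 2) ^ (r + k) := by
          rw [hT2, ← pow_mul, mul_pow]
      _ ≤ (4 * r : ℝ) ^ (2 * (r + k)) * ((Fintype.card α : ℝ) ^ (r + k - 1) *
            ∑ a, (‖F a‖ ^ 2) ^ (r + k)) := by
          gcongr
          exact sum_pow_le_card_pow_mul _ (fun _ => by positivity) (by omega)
      _ = _ := by simp_rw [← pow_mul]; ring

theorem integral_norm_trigSum_pow {ι d : Type*} [Fintype ι] [Fintype d] (ν : ι → d → ℤ) (k : ℕ) :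
    ∫ t, ‖trigSum ν t‖ ^ (2 * k) ∂torusMeasure d
      = diffCount (fun x : Fin k → ι => ∑ i, ν (x i)) 0 := by
  rw [← integral_norm_sq_trigSum]
  refine integral_congr_ae (Filter.Eventually.of_forall fun t => ?_)
  simp only [← trigSum_pow, norm_pow]
  ring

theorem trigSum_eq_sum_class (r n p : ℕ) (t : UnitAddTorus (Fin r)) :
    trigSum (fun x : Fin (n * p) => momentVec r ((x : ℕ) : ℤ)) t
      = ∑ a : Fin p, trigSum (fun w : Fin n => momentVec r ((a : ℕ) + p * ((w : ℕ) : ℤ))) t := by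
  simp only [trigSum]
  rw [← (finProdFinEquiv (m := n) (n := p)).sum_comp, Fintype.sum_prod_type_right]
  refine sum_congr rfl fun a _ => sum_congr rfl fun w _ => ?_
  simp [finProdFinEquiv]

theorem sum_distinct_prod_eq_trigSum (r n p : ℕ) (t : UnitAddTorus (Fin r)) :
    ∑ o : Fin r ↪ Fin p, ∏ i,
        trigSum (fun w : Fin n => momentVec r ((o i : ℕ) + p * ((w : ℕ) : ℤ))) t
      = trigSum (distinctVec r p n) t := by
  simp only [trigSum]
  rw [Fintype.sum_prod_type]
  refine sum_congr rfl fun o _ => ?_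
  rw [Fintype.prod_sum]
  refine sum_congr rfl fun w _ => ?_
  simp [distinctVec, mFourier_sum]

/-- The recursive inequality for Vinogradov's mean value. -/
theorem vinogradovJ_succ_le {p r m k : ℕ} (hp : p.Prime) (hr : r < p) (hm : r ≤ m + 1)
    (hk : 1 ≤ k) :
    (vinogradovJ r (r + k) (p ^ (m + 1)) : ℝ) ≤
      4 * (p : ℝ) ^ (2 * k) * (vinogradovJ r k (p ^ m) *
        (((r * p ^ (m + 1 - r)) ^ r * p ^ (∑ j ∈ range r, (r - (j + 1)))) * (p ^ (m + 1)) ^ r)) +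
      (4 * r : ℝ) ^ (2 * (r + k)) * (p : ℝ) ^ (r + k) * vinogradovJ r (r + k) (p ^ m) := by
  set n := p ^ m with hn
  set F : Fin p → UnitAddTorus (Fin r) → ℂ := fun a =>
    trigSum (fun w : Fin n => momentVec r ((a : ℕ) + p * ((w : ℕ) : ℤ))) with hF
  have hFc : ∀ a, Continuous (F a) := fun a => continuous_trigSum _
  have hE : Continuous (trigSum (distinctVec r p n)) := continuous_trigSum _
  have h1 : (vinogradovJ r (r + k) (p ^ (m + 1)) : ℝ)
      = ∫ t, ‖∑ a, F a t‖ ^ (2 * (r + k)) ∂torusMeasure (Fin r) := by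
    rw [pow_succ, vinogradovJ,
      ← integral_norm_trigSum_pow (fun x : Fin (p ^ m * p) => momentVec r ((x : ℕ) : ℤ))]
    simp_rw [trigSum_eq_sum_class, hF]
    rfl
  have hM : ∀ a, ∫ t, ‖trigSum (distinctVec r p n) t‖ ^ 2 * ‖F a t‖ ^ (2 * k)
      ∂torusMeasure (Fin r) ≤ vinogradovJ r k n *
        (((r * p ^ (m + 1 - r)) ^ r * p ^ (∑ j ∈ range r, (r - (j + 1)))) * (p ^ (m + 1)) ^ r) := by
    intro a
    have h2 := diffCount_distinct_le (m := m + 1) k hp hr hm (by omega) ((a : ℕ) : ℤ)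
    rw [Nat.add_sub_cancel] at h2
    have h3 := integral_norm_sq_trigSum
      (fun z : ((Fin r ↪ Fin p) × (Fin r → Fin n)) × (Fin k → Fin n) =>
        distinctVec r p n z.1 + ∑ i, momentVec r ((a : ℕ) + p * ((z.2 i : ℕ) : ℤ)))
    have h4 : ∀ t, ‖trigSum (distinctVec r p n) t‖ ^ 2 * ‖F a t‖ ^ (2 * k) =
        ‖trigSum (fun z : ((Fin r ↪ Fin p) × (Fin r → Fin n)) × (Fin k → Fin n) =>
        distinctVec r p n z.1 + ∑ i, momentVec r ((a : ℕ) + p * ((z.2 i : ℕ) : ℤ))) t‖ ^ 2 := by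
      intro t
      rw [← trigSum_mul (distinctVec r p n)
        (fun x : Fin k → Fin n => ∑ i, momentVec r ((a : ℕ) + p * ((x i : ℕ) : ℤ))),
        ← trigSum_pow (fun w : Fin n => momentVec r ((a : ℕ) + p * ((w : ℕ) : ℤ))), norm_mul,
        norm_pow, hF]
      ring
    simp_rw [h4, h3]
    exact_mod_cast h2
  have hJ : ∀ a, ∫ t, ‖F a t‖ ^ (2 * (r + k)) ∂torusMeasure (Fin r)
      ≤ vinogradovJ r (r + k) n := by
    intro a
    rw [integral_norm_trigSum_pow]
    exact_mod_cast diffCount_class_le r (r + k) n p hp.pos ((a : ℕ) : ℤ)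
  have hpt : ∀ t, ‖∑ a, F a t‖ ^ (2 * (r + k)) ≤
      4 * (p : ℝ) ^ (2 * k - 1) *
        ∑ a, ‖trigSum (distinctVec r p n) t‖ ^ 2 * ‖F a t‖ ^ (2 * k) +
      (4 * r : ℝ) ^ (2 * (r + k)) * (p : ℝ) ^ (r + k - 1) *
        ∑ a, ‖F a t‖ ^ (2 * (r + k)) := by
    intro t
    have := norm_sum_pow_le_distinct_add (fun a => F a t) r k hk
    rw [sum_distinct_prod_eq_trigSum, Fintype.card_fin] at this
    exact this
  rw [h1]
  refine (integral_mono (integrable_torus (by fun_prop)) (integrable_torus (by fun_prop)) hpt).trans ?_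
  rw [integral_add (integrable_torus (by fun_prop)) (integrable_torus (by fun_prop)),
    integral_const_mul, integral_const_mul,
    integral_finsetSum _ fun a _ => integrable_torus (by fun_prop),
    integral_finsetSum _ fun a _ => integrable_torus (by fun_prop)]
  have e1 : (p : ℝ) ^ (2 * k) = p ^ (2 * k - 1) * p := by
    rw [← pow_succ]; congr 1; omega
  have e2 : (p : ℝ) ^ (r + k) = p ^ (r + k - 1) * p := by
    rw [← pow_succ]; congr 1; omega
  rw [e1, e2]
  refine add_le_add ?_ ?_
  · refine (mul_le_mul_of_nonneg_left (sum_le_sum fun a _ => hM a) (by positivity)).trans_eq ?_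
    simp only [sum_const, card_univ, Fintype.card_fin, nsmul_eq_mul]
    ring
  · refine (mul_le_mul_of_nonneg_left (sum_le_sum fun a _ => hJ a) (by positivity)).trans_eq ?_
    simp only [sum_const, card_univ, Fintype.card_fin, nsmul_eq_mul]
    ring

theorem vinogradovJ_le_trivial (r k P : ℕ) : vinogradovJ r k P ≤ P ^ (2 * k) := by
  refine (card_filter_le _ _).trans_eq ?_
  rw [card_univ, Fintype.card_prod, Fintype.card_fun, Fintype.card_fin, Fintype.card_fin, two_mul,
    pow_add]

theorem sum_range_sub_add_sum_range (r : ℕ) :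
    ∑ j ∈ range r, (r - (j + 1)) + ∑ j ∈ range r, (j + 1) = r * r := by
  rw [← sum_add_distrib, sum_congr rfl (g := fun _ => r) fun j hj => by
    have := mem_range.mp hj; omega]
  simp

theorem sum_range_succ_mul_two (r : ℕ) : (∑ j ∈ range r, (j + 1)) * 2 = r * (r + 1) := by
  have h := Finset.sum_range_id_mul_two (r + 1)
  rw [Finset.sum_range_succ'] at h
  simpa [mul_comm] using h

/-- In the recursion for the mean value, the tuples without `r` distinct residues contribute at most
half of the bound. -/
theorem two_mul_pow_le_of_large {p r k s : ℕ} (hr : 1 ≤ r) (hp : (4 * r) ^ 5 ≤ p) (hk : 1 ≤ k)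
    (hs : 2 * s ≤ k) : 2 * ((4 * r : ℝ) ^ (2 * k) * (p : ℝ) ^ s) ≤ (p : ℝ) ^ k := by
  have hr' : (1 : ℝ) ≤ r := by exact_mod_cast hr
  have hp' : (4 * r : ℝ) ^ 5 ≤ p := by exact_mod_cast hp
  have hp1 : (1 : ℝ) ≤ p := (one_le_pow₀ (by linarith)).trans hp'
  refine (pow_le_pow_iff_left₀ (by positivity) (by positivity) two_ne_zero).mp ?_
  calc (2 * ((4 * r : ℝ) ^ (2 * k) * (p : ℝ) ^ s)) ^ 2
      = 4 * (4 * r : ℝ) ^ (4 * k) * (p : ℝ) ^ (2 * s) := by ring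
    _ ≤ (4 * r : ℝ) ^ k * (4 * r : ℝ) ^ (4 * k) * (p : ℝ) ^ k := by
        gcongr
        · calc (4 : ℝ) ≤ (4 * r) ^ 1 := by linarith
            _ ≤ (4 * r) ^ k := pow_le_pow_right₀ (by linarith) hk
    _ = ((4 * r : ℝ) ^ 5) ^ k * (p : ℝ) ^ k := by
        rw [← pow_add, ← pow_mul]; congr 2; ring
    _ ≤ (p : ℝ) ^ k * (p : ℝ) ^ k := by gcongr
    _ = ((p : ℝ) ^ k) ^ 2 := by ring

/-- **Vinogradov's mean value theorem** with a fixed prime: each step of the recursion gains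
`p ^ (r (r + 1) / 2)` over the trivial bound, until the scale `p ^ r` is reached. -/
theorem vinogradovJ_mul_le {p r : ℕ} (hp : p.Prime) (hr : 1 ≤ r) (hpr : (4 * r) ^ 5 ≤ p) (m : ℕ) :
    ∀ l : ℕ, (vinogradovJ r (r * (r + 1 + l)) (p ^ m) : ℝ) * (p : ℝ) ^ (m * ∑ j ∈ range r, (j + 1))
      ≤ (8 * (r : ℝ) ^ r) ^ l * (p : ℝ) ^ (2 * m * (r * (r + 1 + l))) *
        (p : ℝ) ^ ((∑ j ∈ range r, (j + 1)) * max r (m - l)) := by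
  have hr' : (1 : ℝ) ≤ r := by exact_mod_cast hr
  have hrp : r < p := by
    refine lt_of_lt_of_le ?_ hpr
    calc r < 4 * r := by omega
      _ ≤ (4 * r) ^ 5 := Nat.le_self_pow (by norm_num) _
  have hp1 : (1 : ℝ) ≤ p := by exact_mod_cast hp.one_lt.le
  set s := ∑ j ∈ range r, (j + 1) with hs
  have hs2 : s * 2 = r * (r + 1) := sum_range_succ_mul_two r
  have hC : (1 : ℝ) ≤ 8 * (r : ℝ) ^ r := by
    have := one_le_pow₀ hr' (n := r); linarith
  have htriv : ∀ m l : ℕ, m ≤ max r (m - l) →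
      (vinogradovJ r (r * (r + 1 + l)) (p ^ m) : ℝ) * (p : ℝ) ^ (m * s)
      ≤ (8 * (r : ℝ) ^ r) ^ l * (p : ℝ) ^ (2 * m * (r * (r + 1 + l))) *
        (p : ℝ) ^ (s * max r (m - l)) := by
    intro m l hml
    have h1 : (vinogradovJ r (r * (r + 1 + l)) (p ^ m) : ℝ) ≤
        (p : ℝ) ^ (2 * m * (r * (r + 1 + l))) := by
      have := vinogradovJ_le_trivial r (r * (r + 1 + l)) (p ^ m)
      rw [← pow_mul, show m * (2 * (r * (r + 1 + l))) = 2 * m * (r * (r + 1 + l)) by ring] at this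
      exact_mod_cast this
    have h2 : (p : ℝ) ^ (m * s) ≤ (p : ℝ) ^ (s * max r (m - l)) :=
      pow_le_pow_right₀ hp1 (by rw [mul_comm]; exact Nat.mul_le_mul_left _ hml)
    have h3 : (1 : ℝ) ≤ (8 * (r : ℝ) ^ r) ^ l := one_le_pow₀ hC
    gcongr
    exact h1.trans (le_mul_of_one_le_left (by positivity) h3)
  induction m with
  | zero => exact fun l => htriv 0 l (by omega)
  | succ m ih =>
    intro l
    rcases l with _ | l
    · exact htriv _ _ (by simp)
    rcases Nat.lt_or_ge m r with hmr | hmr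
    · exact htriv _ _ (le_max_of_le_left hmr)
    set k := r * (r + 1 + l) with hk
    have hkk : r * (r + 1 + (l + 1)) = r + k := by rw [hk]; ring
    have hk1 : 1 ≤ k := Nat.mul_pos hr (by omega)
    have hrec := vinogradovJ_succ_le (m := m) (k := k) hp hrp (by omega) hk1
    have hb := two_mul_pow_le_of_large (s := s) (k := r + k) hr hpr (by omega) (by
      rw [mul_comm, hs2, hk]; nlinarith)
    have ih1 := ih l
    have ih2 := ih (l + 1)
    rw [hkk] at ih2 ⊢
    rw [← hk] at ih1
    rw [show m + 1 - (l + 1) = m - l by omega]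
    set M := max r (m - l) with hM
    set C := 8 * (r : ℝ) ^ r with hCdef
    have hu := sum_range_sub_add_sum_range r
    set u := ∑ j ∈ range r, (r - (j + 1)) with hu'
    -- the solutions with distinct residues
    have hA : 4 * (p : ℝ) ^ (2 * k) * (vinogradovJ r k (p ^ m) *
        (((r * p ^ (m + 1 - r)) ^ r * p ^ u) * (p ^ (m + 1)) ^ r)) * (p : ℝ) ^ ((m + 1) * s)
        ≤ C ^ (l + 1) * (p : ℝ) ^ (2 * (m + 1) * (r + k)) * (p : ℝ) ^ (s * M) / 2 := by
      have hexp : 2 * k + (m + 1 - r) * r + u + (m + 1) * r + s + 2 * m * k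
          = 2 * (m + 1) * (r + k) := by
        obtain ⟨e, he⟩ := Nat.exists_eq_add_of_le hmr
        have : m + 1 - r = e + 1 := by omega
        rw [this, he]
        nlinarith
      calc _ = 4 * (r : ℝ) ^ r * (p : ℝ) ^ (2 * k + (m + 1 - r) * r + u + (m + 1) * r + s) *
            (vinogradovJ r k (p ^ m) * (p : ℝ) ^ (m * s)) := by
            rw [mul_pow, ← pow_mul, ← pow_mul]
            ring
        _ ≤ 4 * (r : ℝ) ^ r * (p : ℝ) ^ (2 * k + (m + 1 - r) * r + u + (m + 1) * r + s) *
            (C ^ l * (p : ℝ) ^ (2 * m * k) * (p : ℝ) ^ (s * M)) := by gcongr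
        _ = (8 * (r : ℝ) ^ r) * C ^ l * ((p : ℝ) ^ (2 * k + (m + 1 - r) * r + u + (m + 1) * r + s) *
            (p : ℝ) ^ (2 * m * k)) * (p : ℝ) ^ (s * M) / 2 := by ring
        _ = _ := by rw [← pow_add, hexp, ← hCdef, ← pow_succ']
    -- the solutions concentrated in few residue classes
    have hB : (4 * r : ℝ) ^ (2 * (r + k)) * (p : ℝ) ^ (r + k) * vinogradovJ r (r + k) (p ^ m) *
        (p : ℝ) ^ ((m + 1) * s)
        ≤ C ^ (l + 1) * (p : ℝ) ^ (2 * (m + 1) * (r + k)) * (p : ℝ) ^ (s * M) / 2 := by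
      have hmono : (p : ℝ) ^ (s * max r (m - (l + 1))) ≤ (p : ℝ) ^ (s * M) :=
        pow_le_pow_right₀ hp1 (Nat.mul_le_mul_left _ (max_le_max_left _ (by omega)))
      calc _ = ((4 * r : ℝ) ^ (2 * (r + k)) * (p : ℝ) ^ s) * (p : ℝ) ^ (r + k) *
            (vinogradovJ r (r + k) (p ^ m) * (p : ℝ) ^ (m * s)) := by ring
        _ ≤ ((p : ℝ) ^ (r + k) / 2) * (p : ℝ) ^ (r + k) *
            (C ^ (l + 1) * (p : ℝ) ^ (2 * m * (r + k)) *
              (p : ℝ) ^ (s * max r (m - (l + 1)))) := by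
            gcongr
            linarith
        _ ≤ ((p : ℝ) ^ (r + k) / 2) * (p : ℝ) ^ (r + k) *
            (C ^ (l + 1) * (p : ℝ) ^ (2 * m * (r + k)) * (p : ℝ) ^ (s * M)) := by gcongr
        _ = _ := by ring
    calc _ ≤ (4 * (p : ℝ) ^ (2 * k) * (vinogradovJ r k (p ^ m) *
        (((r * p ^ (m + 1 - r)) ^ r * p ^ u) * (p ^ (m + 1)) ^ r)) +
        (4 * r : ℝ) ^ (2 * (r + k)) * (p : ℝ) ^ (r + k) * vinogradovJ r (r + k) (p ^ m)) *
        (p : ℝ) ^ ((m + 1) * s) := by gcongr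
      _ ≤ _ := by rw [add_mul]; linarith

/-! ### Bilinear exponential sums -/

section
variable {d ι : Type*} [Fintype d] [Fintype ι]

/-- The bicharacter `∏ j, ζ j ^ (u j * v j)` of `ℤ^d`. -/
noncomputable def pairing (ζ : d → ℂ) (u v : d → ℤ) : ℂ := ∏ j, ζ j ^ (u j * v j)

theorem pairing_comm (ζ : d → ℂ) (u v : d → ℤ) : pairing ζ u v = pairing ζ v u := by
  simp only [pairing, mul_comm]

theorem ne_zero_of_norm_eq_one {z : ℂ} (h : ‖z‖ = 1) : z ≠ 0 := by
  rintro rfl; simp at h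

theorem pairing_add {ζ : d → ℂ} (hζ : ∀ j, ‖ζ j‖ = 1) (u u' v : d → ℤ) :
    pairing ζ (u + u') v = pairing ζ u v * pairing ζ u' v := by
  simp only [pairing, Pi.add_apply, add_mul, ← prod_mul_distrib]
  exact prod_congr rfl fun j _ => zpow_add₀ (ne_zero_of_norm_eq_one (hζ j)) _ _

theorem pairing_sub {ζ : d → ℂ} (hζ : ∀ j, ‖ζ j‖ = 1) (u u' v : d → ℤ) :
    pairing ζ (u - u') v = pairing ζ u v * (starRingEnd ℂ) (pairing ζ u' v) := by
  simp only [pairing, Pi.sub_apply, sub_mul, map_prod, ← prod_mul_distrib]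
  refine prod_congr rfl fun j _ => ?_
  rw [zpow_sub₀ (ne_zero_of_norm_eq_one (hζ j)), div_eq_mul_inv, Complex.inv_def,
    Complex.normSq_eq_norm_sq, norm_zpow, hζ j]
  simp

theorem pairing_sum {ζ : d → ℂ} (hζ : ∀ j, ‖ζ j‖ = 1) {α : Type*} (s : Finset α) (u : α → d → ℤ)
    (v : d → ℤ) : pairing ζ (∑ i ∈ s, u i) v = ∏ i ∈ s, pairing ζ (u i) v := by
  classical
  induction s using Finset.induction_on with
  | empty => simp [pairing]
  | insert a s ha ih => rw [sum_insert ha, prod_insert ha, pairing_add hζ, ih]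

/-- The exponential sum attached to a family of frequencies and a point. -/
noncomputable def pairSum (ζ : d → ℂ) (ν : ι → d → ℤ) (v : d → ℤ) : ℂ := ∑ i, pairing ζ (ν i) v

theorem norm_sq_pairSum {ζ : d → ℂ} (hζ : ∀ j, ‖ζ j‖ = 1) (ν : ι → d → ℤ) (v : d → ℤ) :
    ((‖pairSum ζ ν v‖ ^ 2 : ℝ) : ℂ) = ∑ z : ι × ι, pairing ζ (ν z.1 - ν z.2) v := by
  rw [Complex.ofReal_pow, ← Complex.mul_conj', pairSum, map_sum, sum_mul_sum,
    ← Finset.univ_product_univ, sum_product]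
  simp_rw [pairing_sub hζ]

theorem pairSum_pow {ζ : d → ℂ} (hζ : ∀ j, ‖ζ j‖ = 1) (ν : ι → d → ℤ) (v : d → ℤ) (k : ℕ) :
    pairSum ζ ν v ^ k = pairSum ζ (fun X : Fin k → ι => ∑ i, ν (X i)) v := by
  simp only [pairSum, pairing_sum hζ]
  rw [Fintype.sum_pow]

theorem norm_pairSum_pow {ζ : d → ℂ} (hζ : ∀ j, ‖ζ j‖ = 1) (ν : ι → d → ℤ) (v : d → ℤ) (k : ℕ) :
    ((‖pairSum ζ ν v‖ ^ (2 * k) : ℝ) : ℂ)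
      = ∑ z : (Fin k → ι) × (Fin k → ι),
        pairing ζ (∑ i, ν (z.1 i) - ∑ i, ν (z.2 i)) v := by
  rw [← norm_sq_pairSum hζ (fun X : Fin k → ι => ∑ i, ν (X i)), ← pairSum_pow hζ, norm_pow,
    ← pow_mul, mul_comm]

/-- Summing a nonnegative function over the differences of a family costs at most the number of
coincidences. -/
theorem sum_differences_le (ν : ι → d → ℤ) (B : Finset (d → ℤ)) (hB : ∀ i i', ν i - ν i' ∈ B)
    (f : (d → ℤ) → ℝ) (hf : ∀ v, 0 ≤ f v) :
    ∑ z : ι × ι, f (ν z.1 - ν z.2) ≤ diffCount ν 0 * ∑ v ∈ B, f v := by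
  classical
  rw [← sum_fiberwise_of_maps_to (g := fun z : ι × ι => ν z.1 - ν z.2) (t := B)
    (fun z _ => hB _ _), mul_sum]
  refine sum_le_sum fun v _ => ?_
  rw [sum_congr rfl (g := fun _ => f v) fun z hz => by rw [(mem_filter.mp hz).2], sum_const,
    nsmul_eq_mul]
  refine mul_le_mul_of_nonneg_right ?_ (hf v)
  exact_mod_cast diffCount_le_zero ν v

variable [DecidableEq d]

/-- The box `∏ [-L j, L j]`. -/
noncomputable def symmBox (L : d → ℕ) : Finset (d → ℤ) := Fintype.piFinset fun j => Finset.Icc (-(L j : ℤ)) (L j)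

/-- Majorization of a box by a positive definite (Fejér) weight: every point of the box is a
difference of two points of `∏ [0, 2 L j)` in at least `∏ L j` ways. -/
theorem prod_mul_sum_symmBox_le (L : d → ℕ) (f : (d → ℤ) → ℝ) (hf : ∀ v, 0 ≤ f v) :
    (∏ j, (L j : ℝ)) * ∑ v ∈ symmBox L, f v ≤
      ∑ z : (∀ j, Fin (2 * L j)) × (∀ j, Fin (2 * L j)),
        f ((fun j => ((z.1 j : ℕ) : ℤ)) - fun j => ((z.2 j : ℕ) : ℤ)) := by
  have hbd : ∀ v ∈ symmBox L, ∀ j, -(L j : ℤ) ≤ v j ∧ v j ≤ L j := fun v hv j => by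
    simpa using (Fintype.mem_piFinset.mp hv) j
  have h1 : (∏ j, (L j : ℝ)) * ∑ v ∈ symmBox L, f v
      = ∑ q : symmBox L × (∀ j, Fin (L j)), f q.1.1 := by
    rw [Fintype.sum_prod_type, mul_sum, ← sum_coe_sort (symmBox L)]
    refine sum_congr rfl fun v _ => ?_
    simp [Fintype.card_pi]
  set φ : symmBox L × (∀ j, Fin (L j)) → (∀ j, Fin (2 * L j)) × (∀ j, Fin (2 * L j)) :=
    fun q => (fun j => ⟨(q.2 j : ℕ) + (q.1.1 j).toNat, by
        have := hbd _ q.1.2 j; have := (q.2 j).2; omega⟩,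
      fun j => ⟨(q.2 j : ℕ) + (-q.1.1 j).toNat, by
        have := hbd _ q.1.2 j; have := (q.2 j).2; omega⟩) with hφ
  have hdiff : ∀ q, ((fun j => (((φ q).1 j : ℕ) : ℤ)) - fun j => (((φ q).2 j : ℕ) : ℤ)) = q.1.1 := by
    intro q
    funext j
    simp only [hφ, Pi.sub_apply]
    push_cast
    omega
  have hinj : Function.Injective φ := by
    intro q q' h
    have h1 : q.1.1 = q'.1.1 := by rw [← hdiff q, ← hdiff q', h]
    refine Prod.ext (Subtype.ext h1) (funext fun j => Fin.ext ?_)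
    have h2 := congrArg (fun z => ((z.1 j : ℕ))) h
    simp only [hφ, h1] at h2
    omega
  rw [h1, ← sum_congr rfl fun q _ => congrArg f (hdiff q),
    ← sum_image (f := fun z : (∀ j, Fin (2 * L j)) × (∀ j, Fin (2 * L j)) =>
      f ((fun j => ((z.1 j : ℕ) : ℤ)) - fun j => ((z.2 j : ℕ) : ℤ))) hinj.injOn]
  exact sum_le_sum_of_subset_of_nonneg (subset_univ _) fun z _ _ => hf _

theorem sum_symmBox_norm_sq (ζ : d → ℂ) (L : d → ℕ) :
    ∑ v ∈ symmBox L, ‖pairSum ζ (fun h : ∀ j, Fin (2 * L j) => fun j => ((h j : ℕ) : ℤ)) v‖ ^ 2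
      = ∏ j, ∑ μ ∈ Finset.Icc (-(L j : ℤ)) (L j),
          ‖∑ h ∈ range (2 * L j), ζ j ^ ((h : ℤ) * μ)‖ ^ 2 := by
  rw [prod_univ_sum, symmBox]
  refine sum_congr rfl fun v _ => ?_
  simp only [pairSum, pairing]
  rw [← Fintype.prod_sum (fun j (h : Fin (2 * L j)) => ζ j ^ (((h : ℕ) : ℤ) * v j)), norm_prod,
    ← prod_pow]
  refine prod_congr rfl fun j _ => ?_
  rw [Finset.sum_range]

/-- The double large-sieve argument: a bilinear sum over a family of frequencies is bounded by the
number of coincidences among `k`-fold sums and by sums over boxes in one coordinate each. -/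
theorem bilinear_bound {ζ : d → ℂ} (hζ : ∀ j, ‖ζ j‖ = 1) (ν : ι → d → ℤ) {k : ℕ} (hk : 1 ≤ k)
    (L : d → ℕ) (hL : ∀ x x' : Fin k → ι, ∑ i, ν (x i) - ∑ i, ν (x' i) ∈ symmBox L) :
    (∏ j, (L j : ℝ)) * ‖∑ y, pairSum ζ ν (ν y)‖ ^ (2 * k * (2 * k)) ≤
      (Fintype.card ι : ℝ) ^ (4 * k * (2 * k - 1)) *
        (diffCount (fun x : Fin k → ι => ∑ i, ν (x i)) 0 : ℝ) ^ 2 *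
        ∏ j, ∑ μ ∈ Finset.Icc (-(L j : ℤ)) (L j),
          ‖∑ h ∈ range (2 * L j), ζ j ^ ((h : ℤ) * μ)‖ ^ 2 := by
  set J : ℝ := (diffCount (fun x : Fin k → ι => ∑ i, ν (x i)) 0 : ℝ) with hJ
  set c : ℝ := (Fintype.card ι : ℝ) with hc
  set lam : (Fin k → ι) × (Fin k → ι) → d → ℤ := fun z => ∑ i, ν (z.1 i) - ∑ i, ν (z.2 i) with hlam
  set g : (d → ℤ) → ℂ := fun v => pairSum ζ ν v with hg
  have s1 : ‖∑ y, pairSum ζ ν (ν y)‖ ^ (2 * k) ≤ c ^ (2 * k - 1) * ∑ z, ‖g (lam z)‖ := by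
    calc ‖∑ y, pairSum ζ ν (ν y)‖ ^ (2 * k) ≤ (∑ y, ‖pairSum ζ ν (ν y)‖) ^ (2 * k) := by
          gcongr; exact norm_sum_le _ _
      _ ≤ c ^ (2 * k - 1) * ∑ y, ‖pairSum ζ ν (ν y)‖ ^ (2 * k) :=
          sum_pow_le_card_pow_mul _ (fun _ => norm_nonneg _) (by omega)
      _ ≤ c ^ (2 * k - 1) * ∑ z, ‖g (lam z)‖ := by
          gcongr
          have : ((∑ y, ‖pairSum ζ ν (ν y)‖ ^ (2 * k) : ℝ) : ℂ) = ∑ z, g (lam z) := by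
            rw [Complex.ofReal_sum]
            simp_rw [norm_pairSum_pow hζ, hg, pairSum]
            rw [sum_comm]
            simp_rw [hlam, pairing_comm ζ (ν _)]
          rw [← Complex.norm_of_nonneg (r := ∑ y, ‖pairSum ζ ν (ν y)‖ ^ (2 * k))
            (sum_nonneg fun _ _ => by positivity), this]
          exact norm_sum_le _ _
  have hcard : (Fintype.card ((Fin k → ι) × (Fin k → ι)) : ℝ) = c ^ (2 * k) := by
    rw [Fintype.card_prod, Fintype.card_fun, Fintype.card_fin, two_mul, pow_add]
    push_cast
    rfl
  have s2 : (∑ z, ‖g (lam z)‖) ^ (2 * k) ≤ c ^ (2 * k * (2 * k - 1)) * ∑ z, ‖g (lam z)‖ ^ (2 * k) := by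
    have := sum_pow_le_card_pow_mul (fun z => ‖g (lam z)‖) (fun _ => norm_nonneg _)
      (n := 2 * k) (by omega)
    rwa [hcard, ← pow_mul] at this
  have s3 : ∑ z, ‖g (lam z)‖ ^ (2 * k) ≤ J * ∑ v ∈ symmBox L, ‖g v‖ ^ (2 * k) :=
    sum_differences_le (fun x : Fin k → ι => ∑ i, ν (x i)) (symmBox L) hL
      (fun v => ‖g v‖ ^ (2 * k)) fun _ => by positivity
  set η : (∀ j, Fin (2 * L j)) → d → ℤ := fun h j => ((h j : ℕ) : ℤ) with hη
  have s4 : (∏ j, (L j : ℝ)) * ∑ v ∈ symmBox L, ‖g v‖ ^ (2 * k) ≤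
      ∑ z, ‖pairSum ζ η (lam z)‖ ^ 2 := by
    refine (prod_mul_sum_symmBox_le L (fun v => ‖g v‖ ^ (2 * k)) fun _ => by positivity).trans_eq ?_
    apply Complex.ofReal_injective
    rw [Complex.ofReal_sum, Complex.ofReal_sum]
    simp_rw [norm_sq_pairSum hζ, hg, norm_pairSum_pow hζ]
    rw [sum_comm]
    exact sum_congr rfl fun w _ => sum_congr rfl fun z _ => pairing_comm _ _ _
  have s5 : ∑ z, ‖pairSum ζ η (lam z)‖ ^ 2 ≤ J * ∑ v ∈ symmBox L, ‖pairSum ζ η v‖ ^ 2 :=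
    sum_differences_le (fun x : Fin k → ι => ∑ i, ν (x i)) (symmBox L) hL
      (fun v => ‖pairSum ζ η v‖ ^ 2) fun _ => by positivity
  rw [sum_symmBox_norm_sq] at s5
  set Q := ∏ j, ∑ μ ∈ Finset.Icc (-(L j : ℤ)) (L j),
          ‖∑ h ∈ range (2 * L j), ζ j ^ ((h : ℤ) * μ)‖ ^ 2
  have hJ0 : 0 ≤ J := Nat.cast_nonneg _
  have hc0 : 0 ≤ c := Nat.cast_nonneg _
  calc (∏ j, (L j : ℝ)) * ‖∑ y, pairSum ζ ν (ν y)‖ ^ (2 * k * (2 * k))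
      = (∏ j, (L j : ℝ)) * (‖∑ y, pairSum ζ ν (ν y)‖ ^ (2 * k)) ^ (2 * k) := by rw [pow_mul]
    _ ≤ (∏ j, (L j : ℝ)) * (c ^ (2 * k - 1) * ∑ z, ‖g (lam z)‖) ^ (2 * k) := by gcongr
    _ = (∏ j, (L j : ℝ)) * (c ^ ((2 * k - 1) * (2 * k)) * (∑ z, ‖g (lam z)‖) ^ (2 * k)) := by
        rw [mul_pow, ← pow_mul]
    _ ≤ (∏ j, (L j : ℝ)) * (c ^ ((2 * k - 1) * (2 * k)) * (c ^ (2 * k * (2 * k - 1)) *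
          (J * ∑ v ∈ symmBox L, ‖g v‖ ^ (2 * k)))) := by
        gcongr
        exact s2.trans (by gcongr)
    _ = c ^ ((2 * k - 1) * (2 * k) + 2 * k * (2 * k - 1)) * J *
          ((∏ j, (L j : ℝ)) * ∑ v ∈ symmBox L, ‖g v‖ ^ (2 * k)) := by rw [pow_add]; ring
    _ ≤ c ^ ((2 * k - 1) * (2 * k) + 2 * k * (2 * k - 1)) * J * (J * Q) := by
        exact mul_le_mul_of_nonneg_left (s4.trans s5) (by positivity)
    _ = c ^ (4 * k * (2 * k - 1)) * J ^ 2 * Q := by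
        rw [show (2 * k - 1) * (2 * k) + 2 * k * (2 * k - 1) = 4 * k * (2 * k - 1) by ring]
        ring

end

theorem norm_eq_one_of_primitiveRoot {ζ : ℂ} {Q : ℕ} (hQ : 1 ≤ Q) (h : IsPrimitiveRoot ζ Q) :
    ‖ζ‖ = 1 :=
  Complex.norm_eq_one_of_pow_eq_one h.pow_eq_one (by omega)

/-- Orthogonality over `c` full periods. -/
theorem sum_range_mul_zpow_primitiveRoot {ζ : ℂ} {Q : ℕ} (hQ : 1 ≤ Q) (h : IsPrimitiveRoot ζ Q)
    (c : ℕ) (v b : ℤ) :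
    ∑ μ ∈ range (c * Q), ζ ^ (v * ((μ : ℤ) - b)) = if (Q : ℤ) ∣ v then ((c * Q : ℕ) : ℂ) else 0 := by
  have hz : ζ ≠ 0 := ne_zero_of_norm_eq_one (norm_eq_one_of_primitiveRoot hQ h)
  have e : ∀ μ : ℕ, ζ ^ (v * ((μ : ℤ) - b)) = (ζ ^ v) ^ μ * ζ ^ (-(v * b)) := fun μ => by
    rw [← zpow_natCast, ← zpow_mul, ← zpow_add₀ hz]
    congr 1; ring
  simp_rw [e, ← sum_mul]
  split_ifs with hd
  · have h1 : ζ ^ v = 1 := (h.zpow_eq_one_iff_dvd v).mpr hd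
    have h2 : ζ ^ (-(v * b)) = 1 := (h.zpow_eq_one_iff_dvd _).mpr ((hd.mul_right b).neg_right)
    simp [h1, h2]
  · have h1 : ζ ^ v ≠ 1 := fun h1 => hd ((h.zpow_eq_one_iff_dvd v).mp h1)
    have h2 : (ζ ^ v) ^ (c * Q) = 1 := by
      rw [← zpow_natCast, ← zpow_mul]
      refine (h.zpow_eq_one_iff_dvd _).mpr ?_
      push_cast
      exact ⟨v * c, by ring⟩
    rw [geom_sum_eq h1, h2]
    simp

theorem card_range_filter_dvd_sub_le (H Q : ℕ) (h : ℤ) :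
    #((range H).filter fun h' : ℕ => (Q : ℤ) ∣ h - h') ≤ H / Q + 1 := by
  rw [← card_range (H / Q + 1)]
  refine card_le_card_of_injOn (fun z => z / Q) (fun z hz => ?_) ?_
  · have := mem_range.mp (mem_filter.mp hz).1
    simp only [coe_range, Set.mem_Iio]
    exact Nat.lt_succ_of_le (Nat.div_le_div_right this.le)
  · intro z hz z' hz' hzz
    have hd := dvd_sub (mem_filter.mp hz').2 (mem_filter.mp hz).2
    rw [sub_sub_sub_cancel_left] at hd
    have hmod : z' ≡ z [MOD Q] := (Nat.modEq_iff_dvd).mpr hd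
    simp only at hzz
    rw [← Nat.div_add_mod z Q, ← Nat.div_add_mod z' Q, hzz, hmod]

/-- Completing the outer sum to full periods and using orthogonality. -/
theorem sum_norm_sq_le_of_primitiveRoot {ζ : ℂ} {Q : ℕ} (hQ : 1 ≤ Q) (hζ : IsPrimitiveRoot ζ Q)
    (L : ℕ) :
    ∑ μ ∈ Finset.Icc (-(L : ℤ)) L, ‖∑ h ∈ range (2 * L), ζ ^ ((h : ℤ) * μ)‖ ^ 2 ≤
      (2 * L + 1 + Q : ℝ) * (2 * L) * (2 * L / Q + 1) := by
  have hn := norm_eq_one_of_primitiveRoot hQ hζ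
  have hz : ζ ≠ 0 := ne_zero_of_norm_eq_one hn
  set c := (2 * L) / Q + 1 with hc
  have hcQ : 2 * L + 1 ≤ c * Q := by
    have := Nat.lt_div_mul_add (a := 2 * L) (b := Q) (by omega)
    rw [hc, add_mul, one_mul]; omega
  have hcQ' : c * Q ≤ 2 * L + Q := by
    rw [hc, add_mul, one_mul]
    have := Nat.div_mul_le_self (2 * L) Q; omega
  set f : ℤ → ℝ := fun μ => ‖∑ h ∈ range (2 * L), ζ ^ ((h : ℤ) * μ)‖ ^ 2 with hf
  have h1 : ∑ μ ∈ Finset.Icc (-(L : ℤ)) L, f μ ≤ ∑ μ ∈ range (c * Q), f ((μ : ℤ) - L) := by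
    rw [← sum_image (f := f) (g := fun μ : ℕ => (μ : ℤ) - L) (by intro a _ b _ hab; simpa using hab)]
    refine sum_le_sum_of_subset_of_nonneg (fun μ hμ => ?_) fun _ _ _ => by positivity
    have := Finset.mem_Icc.mp hμ
    exact mem_image.mpr ⟨(μ + L).toNat, mem_range.mpr (by omega), by omega⟩
  have h2 : ((∑ μ ∈ range (c * Q), f ((μ : ℤ) - L) : ℝ) : ℂ)
      = ((c * Q * ∑ h ∈ range (2 * L), #((range (2 * L)).filter fun h' : ℕ => (Q : ℤ) ∣ h - h') : ℕ)
        : ℂ) := by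
    have e : ∀ μ : ℤ, ((f μ : ℝ) : ℂ) = ∑ h ∈ range (2 * L), ∑ h' ∈ range (2 * L),
        ζ ^ (((h : ℤ) - h') * μ) := by
      intro μ
      rw [hf, Complex.ofReal_pow, ← Complex.mul_conj', map_sum, sum_mul_sum]
      refine sum_congr rfl fun h _ => sum_congr rfl fun h' _ => ?_
      rw [sub_mul, zpow_sub₀ hz, div_eq_mul_inv, Complex.inv_def, Complex.normSq_eq_norm_sq,
        norm_zpow, hn]
      simp
    rw [Complex.ofReal_sum]
    simp_rw [e]
    rw [sum_comm]
    simp_rw [fun h : ℕ => sum_comm (s := range (c * Q)) (t := range (2 * L))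
      (f := fun μ h' => ζ ^ (((h : ℤ) - (h' : ℕ)) * ((μ : ℤ) - L))),
      sum_range_mul_zpow_primitiveRoot hQ hζ, ← sum_filter, sum_const, nsmul_eq_mul, ← sum_mul]
    push_cast
    ring
  have h2' := Complex.ofReal_injective (h2.trans (Complex.ofReal_natCast _).symm)
  have h3 : ∑ h ∈ range (2 * L), #((range (2 * L)).filter fun h' : ℕ => (Q : ℤ) ∣ h - h')
      ≤ 2 * L * (2 * L / Q + 1) := by
    refine (sum_le_sum fun (h : ℕ) _ => card_range_filter_dvd_sub_le (2 * L) Q (h : ℤ)).trans_eq ?_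
    simp
  refine h1.trans (h2'.le.trans ?_)
  have h4 : ((2 * L / Q : ℕ) : ℝ) ≤ 2 * L / Q := by
    refine Nat.cast_div_le.trans_eq ?_
    push_cast; rfl
  calc ((c * Q * ∑ h ∈ range (2 * L), #((range (2 * L)).filter fun h' : ℕ => (Q : ℤ) ∣ h - h') : ℕ)
        : ℝ) ≤ (((2 * L + 1 + Q) * (2 * L * (2 * L / Q + 1)) : ℕ) : ℝ) := by
        exact_mod_cast Nat.mul_le_mul (by omega) h3
    _ ≤ (2 * L + 1 + Q : ℝ) * (2 * L * (2 * L / Q + 1)) := by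
        push_cast
        gcongr
    _ = _ := by ring

/-- The sum of `sum_norm_sq_le_of_primitiveRoot` saves a factor `G` over the trivial bound when the
order `Q` lies between `G` and `L ^ 2 / G`. -/
theorem sum_norm_sq_le_of_window {ζ : ℂ} {Q : ℕ} (hQ : 1 ≤ Q) (hζ : IsPrimitiveRoot ζ Q)
    {L : ℕ} (hL : 1 ≤ L) {G : ℝ} (hG : 0 < G) (hGQ : G = 1 ∨ (G ≤ Q ∧ Q * G ≤ (L : ℝ) ^ 2)) :
    ∑ μ ∈ Finset.Icc (-(L : ℤ)) L, ‖∑ h ∈ range (2 * L), ζ ^ ((h : ℤ) * μ)‖ ^ 2 ≤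
      L * (24 * (L : ℝ) ^ 2 / G) := by
  have hL' : (1 : ℝ) ≤ L := by exact_mod_cast hL
  have hQ' : (1 : ℝ) ≤ Q := by exact_mod_cast hQ
  rcases hGQ with rfl | ⟨h1, h2⟩
  · have hn := norm_eq_one_of_primitiveRoot hQ hζ
    have hb : ∀ μ : ℤ, ‖∑ h ∈ range (2 * L), ζ ^ ((h : ℤ) * μ)‖ ^ 2 ≤ (2 * L : ℝ) ^ 2 := by
      intro μ
      gcongr
      refine (norm_sum_le _ _).trans_eq ?_
      simp [norm_zpow, hn]
    refine (sum_le_sum fun μ _ => hb μ).trans ?_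
    have hc : (#(Finset.Icc (-(L : ℤ)) L) : ℝ) = 2 * L + 1 := by
      rw [Int.card_Icc]
      have : ((L : ℤ) + 1 - -(L : ℤ)).toNat = 2 * L + 1 := by omega
      rw [this]; push_cast; ring
    rw [sum_const, nsmul_eq_mul, hc]
    nlinarith [pow_le_pow_left₀ (by norm_num) hL' 2, pow_pos (lt_of_lt_of_le one_pos hL') 3]
  · refine (sum_norm_sq_le_of_primitiveRoot hQ hζ L).trans ?_
    have hGL : G ≤ L := by
      have : G ^ 2 ≤ (L : ℝ) ^ 2 := by nlinarith
      exact (pow_le_pow_iff_left₀ hG.le (by linarith) two_ne_zero).mp this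
    have a1 : (L : ℝ) ^ 2 / Q ≤ (L : ℝ) ^ 2 / G := by gcongr
    have a2 : (L : ℝ) ≤ (L : ℝ) ^ 2 / G := by
      rw [le_div_iff₀ hG]; nlinarith
    have a3 : (Q : ℝ) ≤ (L : ℝ) ^ 2 / G := by rwa [le_div_iff₀ hG]
    have a4 : (L : ℝ) / Q ≤ (L : ℝ) ^ 2 / Q := by
      gcongr; nlinarith
    have e : (2 * L + 1 + Q : ℝ) * (2 * L) * (2 * L / Q + 1)
        = 2 * L * (4 * ((L : ℝ) ^ 2 / Q) + 2 * (L / Q) + 4 * L + 1 + Q) := by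
      field_simp; ring
    rw [e]
    calc _ ≤ 2 * L * (12 * ((L : ℝ) ^ 2 / G)) := by
          gcongr; linarith
      _ = _ := by ring

/-- A bilinear sum with polynomial phase in `x y` whose coefficients are primitive roots of
unity of orders `Q j`. -/
noncomputable def polyBilinearSum {r : ℕ} (ζ : Fin r → ℂ) (P : ℕ) : ℂ :=
  ∑ y ∈ range P, ∑ x ∈ range P, ∏ j, ζ j ^ ((x * y) ^ ((j : ℕ) + 1))

theorem polyBilinearSum_bound {r k P : ℕ} (hk : 1 ≤ k) (hP : 1 ≤ P) (ζ : Fin r → ℂ)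
    (Q : Fin r → ℕ) (hQ : ∀ j, 1 ≤ Q j) (hζ : ∀ j, IsPrimitiveRoot (ζ j) (Q j)) (G : Fin r → ℝ)
    (hG : ∀ j, 0 < G j) (hGQ : ∀ j, G j = 1 ∨
      (G j ≤ Q j ∧ Q j * G j ≤ ((k : ℝ) * (P : ℝ) ^ ((j : ℕ) + 1)) ^ 2)) :
    ‖polyBilinearSum ζ P‖ ^ (2 * k * (2 * k)) * ∏ j, G j ≤
      (P : ℝ) ^ (4 * k * (2 * k - 1)) * (vinogradovJ r k P : ℝ) ^ 2 *
        ((24 * (k : ℝ) ^ 2) ^ r * (P : ℝ) ^ (2 * ∑ j ∈ range r, (j + 1))) := by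
  have hn : ∀ j, ‖ζ j‖ = 1 := fun j => norm_eq_one_of_primitiveRoot (hQ j) (hζ j)
  set L : Fin r → ℕ := fun j => k * P ^ ((j : ℕ) + 1) with hL
  have hL1 : ∀ j, 1 ≤ L j := fun j => Nat.mul_pos hk (pow_pos hP _)
  set ν : Fin P → Fin r → ℤ := fun x => momentVec r ((x : ℕ) : ℤ) with hν
  have hbox : ∀ x x' : Fin k → Fin P, ∑ i, ν (x i) - ∑ i, ν (x' i) ∈ symmBox L := by
    intro x x'
    refine Fintype.mem_piFinset.mpr fun j => ?_
    have hb : ∀ x : Fin k → Fin P, 0 ≤ (∑ i, ν (x i)) j ∧ (∑ i, ν (x i)) j ≤ L j := by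
      intro x
      rw [Finset.sum_apply]
      refine ⟨sum_nonneg fun i _ => by simp only [hν, momentVec]; positivity, ?_⟩
      refine (sum_le_card_nsmul univ _ ((P : ℤ) ^ ((j : ℕ) + 1)) fun i _ => ?_).trans_eq ?_
      · simp only [hν, momentVec]
        gcongr
        exact_mod_cast (x i).2.le
      · simp [hL]
    have h1 := hb x
    have h2 := hb x'
    rw [Pi.sub_apply, Finset.mem_Icc]
    omega
  have hW : polyBilinearSum ζ P = ∑ y, pairSum ζ ν (ν y) := by
    rw [polyBilinearSum, Finset.sum_range]
    refine sum_congr rfl fun y _ => ?_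
    rw [Finset.sum_range]
    refine sum_congr rfl fun x _ => prod_congr rfl fun j _ => ?_
    simp only [hν, momentVec]
    rw [← mul_pow, ← zpow_natCast]
    push_cast
    rfl
  have hmain := bilinear_bound hn ν hk L hbox
  rw [← hW, Fintype.card_fin] at hmain
  have hprod : ∏ j, ∑ μ ∈ Finset.Icc (-(L j : ℤ)) (L j),
      ‖∑ h ∈ range (2 * L j), ζ j ^ ((h : ℤ) * μ)‖ ^ 2 ≤
      (∏ j, (L j : ℝ)) * ∏ j, (24 * (L j : ℝ) ^ 2 / G j) := by
    rw [← prod_mul_distrib]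
    refine prod_le_prod (fun j _ => sum_nonneg fun _ _ => by positivity) fun j _ => ?_
    refine sum_norm_sq_le_of_window (hQ j) (hζ j) (hL1 j) (hG j) ?_
    simpa [hL] using hGQ j
  have hLpos : 0 < ∏ j, (L j : ℝ) := prod_pos fun j _ => by exact_mod_cast hL1 j
  have hGpos : 0 < ∏ j, G j := prod_pos fun j _ => hG j
  have h3 : (∏ j, (24 * (L j : ℝ) ^ 2 / G j)) * ∏ j, G j
      = (24 * (k : ℝ) ^ 2) ^ r * (P : ℝ) ^ (2 * ∑ j ∈ range r, (j + 1)) := by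
    rw [← prod_mul_distrib, prod_congr rfl fun j _ => div_mul_cancel₀ _ (hG j).ne']
    simp only [hL, Nat.cast_mul, Nat.cast_pow, mul_pow, ← mul_assoc]
    rw [prod_mul_distrib, prod_const, card_univ, Fintype.card_fin, mul_sum,
      ← Finset.prod_pow_eq_pow_sum, ← Fin.prod_univ_eq_prod_range (fun j => (P : ℝ) ^ (2 * (j + 1))) r]
    congr 1
    · rw [← mul_pow]
    · exact prod_congr rfl fun j _ => by rw [← pow_mul, mul_comm]
  set J : ℝ := (vinogradovJ r k P : ℝ) with hJ
  have h4 : (∏ j, (L j : ℝ)) * ‖polyBilinearSum ζ P‖ ^ (2 * k * (2 * k)) ≤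
      (∏ j, (L j : ℝ)) * ((P : ℝ) ^ (4 * k * (2 * k - 1)) * J ^ 2 *
        ∏ j, (24 * (L j : ℝ) ^ 2 / G j)) := by
    refine hmain.trans ((mul_le_mul_of_nonneg_left hprod (by positivity)).trans_eq ?_)
    rw [hJ, vinogradovJ]
    ring
  have h5 := le_of_mul_le_mul_left h4 hLpos
  rw [← h3]
  exact (mul_le_mul_of_nonneg_right h5 hGpos.le).trans_eq (mul_assoc _ _ _)

/-- The bilinear sum with the mean value bound inserted. -/
theorem polyBilinearSum_prime_bound {p r l : ℕ} (hp : p.Prime) (hr : 1 ≤ r) (hpr : (4 * r) ^ 5 ≤ p)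
    (ζ : Fin r → ℂ) (Q : Fin r → ℕ) (hQ : ∀ j, 1 ≤ Q j) (hζ : ∀ j, IsPrimitiveRoot (ζ j) (Q j))
    (G : Fin r → ℝ) (hG : ∀ j, 0 < G j) {k P : ℕ} (hk : k = r * (r + 1 + l)) (hP : P = p ^ (r + l))
    (hGQ : ∀ j, G j = 1 ∨
      (G j ≤ Q j ∧ Q j * G j ≤ ((k : ℝ) * (P : ℝ) ^ ((j : ℕ) + 1)) ^ 2)) :
    ‖polyBilinearSum ζ P‖ ^ (2 * k * (2 * k)) * ∏ j, G j ≤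
      (P : ℝ) ^ (2 * (2 * k * (2 * k))) * ((8 * (r : ℝ) ^ r) ^ (2 * l) *
        (p : ℝ) ^ (r * (r * (r + 1))) * (24 * (k : ℝ) ^ 2) ^ r) := by
  have hk1 : 1 ≤ k := by rw [hk]; exact Nat.mul_pos hr (by omega)
  have hP1 : 1 ≤ P := by rw [hP]; exact pow_pos hp.pos _
  refine (polyBilinearSum_bound hk1 hP1 ζ Q hQ hζ G hG hGQ).trans ?_
  have hJ := vinogradovJ_mul_le hp hr hpr (r + l) l
  rw [← hk, ← hP, Nat.add_sub_cancel, max_self] at hJ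
  have hs2 := sum_range_succ_mul_two r
  set s := ∑ j ∈ range r, (j + 1) with hs
  have e1 : (p : ℝ) ^ ((r + l) * s) = (P : ℝ) ^ s := by rw [hP]; push_cast; rw [pow_mul]
  have e2 : (p : ℝ) ^ (2 * (r + l) * k) = (P : ℝ) ^ (2 * k) := by
    rw [hP]; push_cast; rw [← pow_mul]; congr 1; ring
  rw [e1, e2] at hJ
  have h2 : (vinogradovJ r k P : ℝ) ^ 2 * (P : ℝ) ^ (2 * s) ≤
      (8 * (r : ℝ) ^ r) ^ (2 * l) * (P : ℝ) ^ (4 * k) * (p : ℝ) ^ (r * (r * (r + 1))) := by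
    calc _ = ((vinogradovJ r k P : ℝ) * (P : ℝ) ^ s) ^ 2 := by ring
      _ ≤ ((8 * (r : ℝ) ^ r) ^ l * (P : ℝ) ^ (2 * k) * (p : ℝ) ^ (s * r)) ^ 2 := by gcongr
      _ = (8 * (r : ℝ) ^ r) ^ (2 * l) * (P : ℝ) ^ (4 * k) * (p : ℝ) ^ (s * 2 * r) := by ring
      _ = _ := by rw [hs2, mul_comm r (r * (r + 1))]
  have e3 : 4 * k * (2 * k - 1) + 4 * k = 2 * (2 * k * (2 * k)) := by
    obtain ⟨k, rfl⟩ := Nat.exists_eq_add_of_le' hk1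
    rw [show 2 * (k + 1) - 1 = 2 * k + 1 by omega]; ring
  calc _ = (P : ℝ) ^ (4 * k * (2 * k - 1)) * (24 * (k : ℝ) ^ 2) ^ r *
        ((vinogradovJ r k P : ℝ) ^ 2 * (P : ℝ) ^ (2 * s)) := by ring
    _ ≤ (P : ℝ) ^ (4 * k * (2 * k - 1)) * (24 * (k : ℝ) ^ 2) ^ r *
        ((8 * (r : ℝ) ^ r) ^ (2 * l) * (P : ℝ) ^ (4 * k) * (p : ℝ) ^ (r * (r * (r + 1)))) := by
        gcongr
    _ = (P : ℝ) ^ (4 * k * (2 * k - 1) + 4 * k) * ((8 * (r : ℝ) ^ r) ^ (2 * l) *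
        (p : ℝ) ^ (r * (r * (r + 1))) * (24 * (k : ℝ) ^ 2) ^ r) := by rw [pow_add]; ring
    _ = _ := by rw [e3]

/-! ### Expansion of the inverse modulo `q` in shifts by a nilpotent modulus -/

/-- There is a modulus `D`, not much larger than `q ^ (1 / R)`, whose `R`-th power is divisible
by `q`: round the exponents of the prime factorization of `q`, divided by `R`, up to integers. -/
theorem exists_root_modulus {q R : ℕ} (hq : q ≠ 0) (hR : 1 ≤ R) :
    ∃ D : ℕ, 1 ≤ D ∧ q ∣ D ^ R ∧ D ^ R ≤ kernel q ^ R * q := by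
  have hfac : ∏ p ∈ q.primeFactors, p ^ q.factorization p = q :=
    Nat.prod_factorization_pow_eq_self hq
  have hpos : ∀ p ∈ q.primeFactors, 0 < p := fun p hp => (Nat.prime_of_mem_primeFactors hp).pos
  refine ⟨∏ p ∈ q.primeFactors, p ^ ((q.factorization p + (R - 1)) / R),
    prod_pos fun p hp => pow_pos (hpos p hp) _, ?_, ?_⟩
  · rw [← prod_pow]
    conv_lhs => rw [← hfac]
    refine prod_dvd_prod_of_dvd _ _ fun p _ => ?_
    rw [← pow_mul]
    refine pow_dvd_pow _ ?_
    have := Nat.lt_div_mul_add (a := q.factorization p + (R - 1)) (b := R) (by omega)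
    omega
  · have hk : kernel q ^ R * q = ∏ p ∈ q.primeFactors, p ^ R * p ^ q.factorization p := by
      rw [prod_mul_distrib, hfac, prod_pow, kernel]
    rw [hk, ← prod_pow]
    refine prod_le_prod' fun p hp => ?_
    rw [← pow_mul, ← pow_add]
    refine Nat.pow_le_pow_right (hpos p hp) ?_
    have := Nat.div_mul_le_self (q.factorization p + (R - 1)) R
    omega

/-- The root of unity `exp (2πi / q)`. -/
noncomputable def rootOfUnity (q : ℕ) : ℂ := Complex.exp (2 * Real.pi * Complex.I / q)

theorem isPrimitiveRoot_rootOfUnity {q : ℕ} (hq : q ≠ 0) : IsPrimitiveRoot (rootOfUnity q) q :=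
  Complex.isPrimitiveRoot_exp q hq

theorem eMod_eq_zpow (q : ℕ) (v : ℤ) : eMod q v = rootOfUnity q ^ v := by
  rw [eMod, rootOfUnity, ← Complex.exp_int_mul]
  congr 1
  ring

theorem eMod_congr {q : ℕ} (hq : q ≠ 0) {v w : ℤ} (h : (v : ZMod q) = w) : eMod q v = eMod q w := by
  have hp := isPrimitiveRoot_rootOfUnity hq
  have hz : rootOfUnity q ≠ 0 := hp.ne_zero hq
  have h1 : rootOfUnity q ^ (v - w) = 1 :=
    (hp.zpow_eq_one_iff_dvd _).mpr ((ZMod.intCast_eq_intCast_iff_dvd_sub _ _ _).mp h.symm)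
  rw [eMod_eq_zpow, eMod_eq_zpow, ← sub_add_cancel v w, zpow_add₀ hz, h1, one_mul]

theorem norm_eMod {q : ℕ} (hq : q ≠ 0) (v : ℤ) : ‖eMod q v‖ = 1 := by
  rw [eMod_eq_zpow, norm_zpow,
    norm_eq_one_of_primitiveRoot (Nat.one_le_iff_ne_zero.mpr hq) (isPrimitiveRoot_rootOfUnity hq),
    one_zpow]

theorem intCast_invMod {q : ℕ} (hq : q ≠ 0) (n : ℤ) : (invMod q n : ZMod q) = (n : ZMod q)⁻¹ := by
  have : NeZero q := ⟨hq⟩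
  rw [invMod, Int.cast_natCast, ZMod.natCast_zmod_val]

theorem gcd_eq_one_iff_isUnit (q : ℕ) (n : ℤ) : Int.gcd n q = 1 ↔ IsUnit (n : ZMod q) := by
  rw [ZMod.coe_int_isUnit_iff_isCoprime, isCoprime_comm, Int.isCoprime_iff_gcd_eq_one]

theorem isUnit_add_nilpotent_iff {A : Type*} [CommRing A] {u t : A} (ht : IsNilpotent t) :
    IsUnit (u + t) ↔ IsUnit u := by
  refine ⟨fun h => ?_, fun h => ?_⟩
  · have := (IsNilpotent.isUnit_add_left_of_commute ht.neg h (Commute.all _ _))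
    simpa using this
  · exact IsNilpotent.isUnit_add_left_of_commute ht h (Commute.all _ _)

/-- The coefficients of the polynomial `a (n + t)⁻¹ + b (n + t) - a n⁻¹ - b n` in `t = D z`. -/
noncomputable def shiftCoeff {q : ℕ} (a b n D : ZMod q) (j : ℕ) : ZMod q :=
  a * n⁻¹ * (-n⁻¹) ^ (j + 1) * D ^ (j + 1) + if j = 0 then b * D else 0

/-- The geometric series for the inverse of `n + D z`, which terminates since `D` is nilpotent. -/
theorem inv_shift_expansion {q r : ℕ} {a b n D : ZMod q} (hn : IsUnit n) (hD : D ^ (r + 1) = 0)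
    (hr : 1 ≤ r) (z : ZMod q) :
    a * (n + D * z)⁻¹ + b * (n + D * z) =
      (a * n⁻¹ + b * n) + ∑ j ∈ range r, shiftCoeff a b n D j * z ^ (j + 1) := by
  have hnn : n * n⁻¹ = 1 := ZMod.mul_inv_of_unit n hn
  set t := -n⁻¹ * (D * z) with ht
  have ht0 : t ^ (r + 1) = 0 := by rw [ht, mul_pow, mul_pow, hD]; ring
  have hinv : (n + D * z) * (n⁻¹ * ∑ j ∈ range (r + 1), t ^ j) = 1 := by
    have h1 := mul_neg_geom_sum t (r + 1)
    rw [ht0, sub_zero] at h1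
    have h2 : (n + D * z) * n⁻¹ = 1 - t := by rw [ht, add_mul, hnn]; ring
    rw [← mul_assoc, h2, h1]
  have hi : (n + D * z)⁻¹ = n⁻¹ * ∑ j ∈ range (r + 1), t ^ j :=
    ZMod.inv_eq_of_mul_eq_one q _ _ hinv
  rw [hi, sum_range_succ']
  simp only [shiftCoeff, add_mul, sum_add_distrib, ite_mul, zero_mul]
  rw [sum_ite_eq' (range r) 0, if_pos (mem_range.mpr hr)]
  have h3 : a * (n⁻¹ * ∑ j ∈ range r, t ^ (j + 1)) =
      ∑ j ∈ range r, a * n⁻¹ * (-n⁻¹) ^ (j + 1) * D ^ (j + 1) * z ^ (j + 1) := by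
    rw [mul_sum, mul_sum]
    refine sum_congr rfl fun j _ => ?_
    rw [ht, mul_pow, mul_pow]; ring
  rw [mul_add, mul_add, h3]
  ring

theorem gcd_val_dvd_of_mul {q : ℕ} (w x : ZMod q) :
    Nat.gcd q x.val ∣ Nat.gcd q (w * x).val := by
  refine Nat.dvd_gcd (Nat.gcd_dvd_left _ _) ?_
  rw [ZMod.val_mul, Nat.dvd_mod_iff (Nat.gcd_dvd_left _ _)]
  exact (Nat.gcd_dvd_right _ _).mul_left _

theorem gcd_val_unit_mul {q : ℕ} {u : ZMod q} (hu : IsUnit u) (x : ZMod q) :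
    Nat.gcd q (u * x).val = Nat.gcd q x.val := by
  refine Nat.dvd_antisymm ?_ (gcd_val_dvd_of_mul u x)
  obtain ⟨u, rfl⟩ := hu
  simpa [← mul_assoc] using gcd_val_dvd_of_mul (↑u⁻¹ : ZMod q) (u * x)

theorem gcd_val_natCast (q m : ℕ) : Nat.gcd q (m : ZMod q).val = Nat.gcd q m := by
  rw [ZMod.val_natCast, Nat.gcd_comm, ← Nat.gcd_rec]

/-- The upper bound `q ^ (1 - j / R)` for the order of the `j`-th coefficient: `q ^ j` divides both
`q ^ R` and `D ^ (j R)`. -/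
theorem div_gcd_pow_le {q D R j : ℕ} (hq : q ≠ 0) (hD : q ∣ D ^ R) (hj : j ≤ R) :
    (q / Nat.gcd q (D ^ j)) ^ R ≤ q ^ (R - j) := by
  set g := Nat.gcd q (D ^ j) with hg
  have hg0 : 0 < g := Nat.gcd_pos_of_pos_left _ (Nat.pos_of_ne_zero hq)
  have h1 : q ^ j ∣ g ^ R := by
    rw [hg, ← Nat.pow_gcd_pow]
    refine Nat.dvd_gcd (pow_dvd_pow q hj) ?_
    rw [← pow_mul, mul_comm, pow_mul]
    exact pow_dvd_pow_of_dvd hD j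
  have h2 : q ^ j ≤ g ^ R := Nat.le_of_dvd (pow_pos hg0 _) h1
  have h3 : (q / g) ^ R * g ^ R = q ^ (R - j) * q ^ j := by
    rw [← mul_pow, Nat.div_mul_cancel (Nat.gcd_dvd_left _ _), ← pow_add, Nat.sub_add_cancel hj]
  have h4 : (q / g) ^ R * q ^ j ≤ q ^ (R - j) * q ^ j := by
    rw [← h3]; exact Nat.mul_le_mul_left _ h2
  exact Nat.le_of_mul_le_mul_right h4 (pow_pos (Nat.pos_of_ne_zero hq) _)

theorem le_div_gcd_mul {q m : ℕ} (hm : 1 ≤ m) : q ≤ q / Nat.gcd q m * m := by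
  conv_lhs => rw [← Nat.div_mul_cancel (Nat.gcd_dvd_left q m)]
  exact Nat.mul_le_mul_left _ (Nat.le_of_dvd hm (Nat.gcd_dvd_right _ _))

/-- Shifting the range of summation by `h` changes a sum of terms bounded by `1` by at
most `2 h`. -/
theorem norm_sum_sub_sum_shift_le {φ : ℤ → ℂ} (hφ : ∀ n, ‖φ n‖ ≤ 1) (c : ℤ) (N h : ℕ) :
    ‖∑ n ∈ Finset.Ioc c (c + N), φ n - ∑ n ∈ Finset.Ioc c (c + N), φ (n + h)‖ ≤ 2 * h := by
  have hr : ∀ ψ : ℤ → ℂ, ∑ n ∈ Finset.Ioc c (c + N), ψ n = ∑ i ∈ range N, ψ (c + 1 + i) := by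
    intro ψ
    rw [← sum_image (f := ψ) (g := fun i : ℕ => c + 1 + (i : ℤ)) (by intro a _ b _ hab; simpa using hab)]
    refine sum_congr ?_ fun _ _ => rfl
    ext n
    simp only [Finset.mem_Ioc, mem_image, mem_range]
    exact ⟨fun hn => ⟨(n - c - 1).toNat, by omega, by omega⟩, by rintro ⟨i, hi, rfl⟩; omega⟩
  induction h with
  | zero => simp
  | succ h ih =>
    have e : ∑ n ∈ Finset.Ioc c (c + N), φ (n + h) - ∑ n ∈ Finset.Ioc c (c + N), φ (n + (h + 1 : ℕ))
        = φ (c + 1 + h) - φ (c + 1 + N + h) := by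
      rw [hr, hr, ← neg_inj, neg_sub, neg_sub, ← sum_sub_distrib]
      have := sum_range_sub (fun i : ℕ => φ (c + 1 + i + h)) N
      simp only [Nat.cast_zero, add_zero] at this
      rw [← this]
      refine sum_congr rfl fun i _ => ?_
      congr 2; push_cast; ring
    have h2 : ‖φ (c + 1 + h) - φ (c + 1 + N + h)‖ ≤ 2 :=
      (norm_sub_le _ _).trans (by linarith [hφ (c + 1 + h), hφ (c + 1 + N + h)])
    rw [← sub_add_sub_cancel _ (∑ n ∈ Finset.Ioc c (c + N), φ (n + h)), e]
    refine (norm_add_le _ _).trans ?_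
    push_cast
    linarith

/-- The summand of the Kloosterman sum, extended by zero to all integers. -/
noncomputable def kloostermanTerm (q : ℕ) (a b n : ℤ) : ℂ :=
  if Int.gcd n (q : ℤ) = 1 then eMod q (a * invMod q n + b * n) else 0

/-- For `n` prime to `q`, the sum of the Kloosterman terms over the shifts `n + D x y` is, up to a
unimodular factor, a bilinear sum with polynomial phase. -/
theorem exists_norm_sum_shift_eq {q r D : ℕ} (hq : q ≠ 0) (hr : 1 ≤ r) (hD1 : 1 ≤ D)
    (hD : q ∣ D ^ (r + 1)) {a : ℤ} (ha : Int.gcd a (q : ℤ) = 1) (b : ℤ) {n : ℤ}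
    (hn : Int.gcd n (q : ℤ) = 1) (P : ℕ) :
    ∃ (ζ : Fin r → ℂ) (Q : Fin r → ℕ), (∀ j, 1 ≤ Q j) ∧ (∀ j, IsPrimitiveRoot (ζ j) (Q j)) ∧
      (∀ j : Fin r, 1 ≤ (j : ℕ) → q ≤ Q j * D ^ ((j : ℕ) + 1) ∧ Q j ^ (r + 1) ≤ q ^ (r - j)) ∧
      ‖∑ y ∈ range P, ∑ x ∈ range P, kloostermanTerm q a b (n + (D * (x * y) : ℕ))‖
        = ‖polyBilinearSum ζ P‖ := by
  have : NeZero q := ⟨hq⟩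
  have hprim := isPrimitiveRoot_rootOfUnity hq
  have hnu : IsUnit (n : ZMod q) := (gcd_eq_one_iff_isUnit q n).mp hn
  have hau : IsUnit (a : ZMod q) := (gcd_eq_one_iff_isUnit q a).mp ha
  have hD0 : (D : ZMod q) ^ (r + 1) = 0 := by
    have := (ZMod.natCast_eq_zero_iff (D ^ (r + 1)) q).mpr hD
    exact_mod_cast this
  set co : ℕ → ZMod q := shiftCoeff (a : ZMod q) b n D with hco
  refine ⟨fun j => rootOfUnity q ^ (co j).val, fun j => q / Nat.gcd q (co j).val, fun j => ?_,
    fun j => ?_, fun j hj => ?_, ?_⟩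
  · exact Nat.div_pos (Nat.gcd_le_left _ (Nat.pos_of_ne_zero hq))
      (Nat.gcd_pos_of_pos_left _ (Nat.pos_of_ne_zero hq))
  · have h1 := IsPrimitiveRoot.orderOf (rootOfUnity q ^ (co j).val)
    have h2 : orderOf (rootOfUnity q ^ (co j).val) = q / Nat.gcd q (co j).val := by
      rw [IsOfFinOrder.orderOf_pow _ _
        (isOfFinOrder_iff_pow_eq_one.mpr ⟨q, Nat.pos_of_ne_zero hq, hprim.pow_eq_one⟩),
        ← hprim.eq_orderOf]
    rwa [h2] at h1
  · have hu : IsUnit ((a : ZMod q) * (n : ZMod q)⁻¹ * (-(n : ZMod q)⁻¹) ^ ((j : ℕ) + 1)) := by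
      have : IsUnit (n : ZMod q)⁻¹ := by
        exact IsUnit.of_mul_eq_one _ (ZMod.inv_mul_of_unit _ hnu)
      exact (hau.mul this).mul (this.neg.pow _)
    have hg : Nat.gcd q (co j).val = Nat.gcd q (D ^ ((j : ℕ) + 1)) := by
      rw [hco, shiftCoeff, if_neg (by omega), add_zero, gcd_val_unit_mul hu, ← Nat.cast_pow,
        gcd_val_natCast]
    simp only [hg]
    refine ⟨le_div_gcd_mul (Nat.one_le_pow _ _ hD1), ?_⟩
    have := div_gcd_pow_le (j := (j : ℕ) + 1) hq hD (by have := j.2; omega)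
    rwa [show r + 1 - ((j : ℕ) + 1) = r - j by omega] at this
  · have hterm : ∀ x y : ℕ, kloostermanTerm q a b (n + (D * (x * y) : ℕ)) =
        eMod q (a * invMod q n + b * n) *
          ∏ j : Fin r, (rootOfUnity q ^ (co j).val) ^ ((x * y) ^ ((j : ℕ) + 1)) := by
      intro x y
      have hcast : ((n + (D * (x * y) : ℕ) : ℤ) : ZMod q) = (n : ZMod q) + D * (x * y : ℕ) := by
        push_cast; ring
      have hcop : Int.gcd (n + (D * (x * y) : ℕ)) (q : ℤ) = 1 := by
        rw [gcd_eq_one_iff_isUnit, hcast, isUnit_add_nilpotent_iff]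
        · exact hnu
        · exact ⟨r + 1, by rw [mul_pow, hD0, zero_mul]⟩
      rw [kloostermanTerm, if_pos hcop]
      have hprod : ∏ j : Fin r, (rootOfUnity q ^ (co j).val) ^ ((x * y) ^ ((j : ℕ) + 1))
          = eMod q ((∑ j ∈ range r, (co j).val * (x * y) ^ (j + 1) : ℕ) : ℤ) := by
        rw [eMod_eq_zpow, zpow_natCast, ← Finset.prod_pow_eq_pow_sum,
          ← Fin.prod_univ_eq_prod_range (fun j => rootOfUnity q ^ ((co j).val * (x * y) ^ (j + 1))) r]
        exact prod_congr rfl fun j _ => (pow_mul _ _ _).symm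
      have hadd : ∀ v w : ℤ, eMod q v * eMod q w = eMod q (v + w) := fun v w => by
        rw [eMod_eq_zpow, eMod_eq_zpow, eMod_eq_zpow, zpow_add₀ (hprim.ne_zero hq)]
      rw [hprod, hadd]
      refine eMod_congr hq ?_
      rw [Int.cast_add, Int.cast_mul, Int.cast_mul, intCast_invMod hq, hcast,
        inv_shift_expansion hnu hD0 hr, Int.cast_add, Int.cast_add, Int.cast_mul, Int.cast_mul,
        intCast_invMod hq]
      congr 1
      push_cast
      refine sum_congr rfl fun j _ => ?_
      rw [ZMod.natCast_zmod_val]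
    simp_rw [hterm, ← mul_sum]
    rw [norm_mul, norm_eMod hq, one_mul, polyBilinearSum]

/-- Reduction of the Kloosterman sum to bilinear sums with polynomial phase. -/
theorem kloostermanSum_le_of_bilinear {q r D : ℕ} (hq : q ≠ 0) (hr : 1 ≤ r) (hD1 : 1 ≤ D)
    (hD : q ∣ D ^ (r + 1)) {a : ℤ} (ha : Int.gcd a (q : ℤ) = 1) (b c : ℤ) (N P : ℕ) (w : ℝ)
    (hw0 : 0 ≤ w)
    (hw : ∀ (ζ : Fin r → ℂ) (Q : Fin r → ℕ), (∀ j, 1 ≤ Q j) → (∀ j, IsPrimitiveRoot (ζ j) (Q j)) →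
      (∀ j : Fin r, 1 ≤ (j : ℕ) → q ≤ Q j * D ^ ((j : ℕ) + 1) ∧ Q j ^ (r + 1) ≤ q ^ (r - j)) →
      ‖polyBilinearSum ζ P‖ ≤ w) :
    (P : ℝ) ^ 2 * ‖kloostermanSum q N a b c‖ ≤ N * w + 2 * D * (P : ℝ) ^ 4 := by
  set φ : ℤ → ℂ := kloostermanTerm q a b with hφ
  have hφ1 : ∀ n, ‖φ n‖ ≤ 1 := by
    intro n
    simp only [hφ, kloostermanTerm]
    split_ifs
    · exact (norm_eMod hq _).le
    · simp
  have hS : kloostermanSum q N a b c = ∑ n ∈ Finset.Ioc c (c + N), φ n := by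
    rw [kloostermanSum, sum_filter]
    rfl
  set S := ∑ n ∈ Finset.Ioc c (c + N), φ n with hSdef
  have hin : ∀ n, ‖∑ y ∈ range P, ∑ x ∈ range P, φ (n + (D * (x * y) : ℕ))‖ ≤ w := by
    intro n
    by_cases hn : Int.gcd n (q : ℤ) = 1
    · obtain ⟨ζ, Q, h1, h2, h3, h4⟩ := exists_norm_sum_shift_eq hq hr hD1 hD ha b hn P
      rw [hφ, h4]
      exact hw ζ Q h1 h2 h3
    · have h0 : ∀ x y : ℕ, φ (n + (D * (x * y) : ℕ)) = 0 := by
        intro x y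
        simp only [hφ, kloostermanTerm]
        refine if_neg fun h => hn ?_
        rw [gcd_eq_one_iff_isUnit] at h ⊢
        rw [show ((n + (D * (x * y) : ℕ) : ℤ) : ZMod q) = (n : ZMod q) + D * (x * y : ℕ) by
          push_cast; ring] at h
        refine (isUnit_add_nilpotent_iff ⟨r + 1, ?_⟩).mp h
        have := (ZMod.natCast_eq_zero_iff (D ^ (r + 1)) q).mpr hD
        rw [Nat.cast_pow] at this
        rw [mul_pow, this, zero_mul]
      rw [sum_eq_zero fun y _ => sum_eq_zero fun x _ => h0 x y, norm_zero]
      exact hw0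
  have hdiff : ‖∑ y ∈ range P, ∑ x ∈ range P,
      (S - ∑ n ∈ Finset.Ioc c (c + N), φ (n + (D * (x * y) : ℕ)))‖ ≤ 2 * D * (P : ℝ) ^ 4 := by
    calc _ ≤ ∑ y ∈ range P, ∑ x ∈ range P, (2 * D * (P : ℝ) ^ 2) := by
          refine (norm_sum_le _ _).trans (sum_le_sum fun y hy => (norm_sum_le _ _).trans
            (sum_le_sum fun x hx => ?_))
          refine (norm_sum_sub_sum_shift_le hφ1 c N _).trans ?_
          have hx : (x : ℝ) ≤ P := by exact_mod_cast (mem_range.mp hx).le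
          have hy : (y : ℝ) ≤ P := by exact_mod_cast (mem_range.mp hy).le
          push_cast
          calc (2 : ℝ) * (D * (x * y)) ≤ 2 * (D * (P * P)) := by gcongr
            _ = _ := by ring
      _ = _ := by simp; ring
  have hsum : ‖∑ y ∈ range P, ∑ x ∈ range P,
      ∑ n ∈ Finset.Ioc c (c + N), φ (n + (D * (x * y) : ℕ))‖ ≤ N * w := by
    have e : ∑ y ∈ range P, ∑ x ∈ range P, ∑ n ∈ Finset.Ioc c (c + N), φ (n + (D * (x * y) : ℕ))
        = ∑ n ∈ Finset.Ioc c (c + N), ∑ y ∈ range P, ∑ x ∈ range P, φ (n + (D * (x * y) : ℕ)) := by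
      rw [sum_comm (s := Finset.Ioc c (c + N))]
      exact sum_congr rfl fun y _ => sum_comm
    rw [e]
    refine (norm_sum_le _ _).trans ((sum_le_sum fun n _ => hin n).trans_eq ?_)
    simp
  have htot : ((P : ℂ) ^ 2) * S = ∑ y ∈ range P, ∑ x ∈ range P,
      (S - ∑ n ∈ Finset.Ioc c (c + N), φ (n + (D * (x * y) : ℕ))) +
      ∑ y ∈ range P, ∑ x ∈ range P, ∑ n ∈ Finset.Ioc c (c + N), φ (n + (D * (x * y) : ℕ)) := by
    simp only [sum_sub_distrib, sum_const, card_range, nsmul_eq_mul]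
    ring
  have h5 : (P : ℝ) ^ 2 * ‖S‖ = ‖((P : ℂ) ^ 2) * S‖ := by simp
  rw [hS, h5, htot]
  refine (norm_add_le _ _).trans ?_
  linarith

/-! ### Choice of parameters -/

/-- The exponents `e = j + 1` in the window `[R / 2, 2 R / 3]`, `R = r + 1`, for which the order of
the `j`-th coefficient is neither too small nor too large. -/
def InWindow (r j : ℕ) : Prop := r + 1 ≤ 2 * (j + 1) ∧ 3 * (j + 1) ≤ 2 * (r + 1)

instance (r j : ℕ) : Decidable (InWindow r j) := by unfold InWindow; infer_instance

theorem le_seven_mul_card_window {r : ℕ} (hr : 5 ≤ r) :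
    r + 1 ≤ 7 * #{j : Fin r | InWindow r j} := by
  have h : #(Finset.Ico (r / 2) ((2 * (r + 1)) / 3)) ≤ #{j : Fin r | InWindow r j} := by
    rw [← card_map Fin.valEmbedding]
    refine card_le_card fun j hj => ?_
    have hj := Finset.mem_Ico.mp hj
    rw [mem_map]
    refine ⟨⟨j, by omega⟩, mem_filter.mpr ⟨mem_univ _, ?_⟩, rfl⟩
    change r + 1 ≤ 2 * (j + 1) ∧ 3 * (j + 1) ≤ 2 * (r + 1)
    omega
  rw [Nat.card_Ico] at h
  omega

/-- The factors of `polyBilinearSum_prime_bound` that do not grow with `p` are negligible: their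
logarithm is `O(R ^ 3)`, against savings of order `R ^ 2 log N`. -/
theorem log_consts_le {r k l : ℕ} (hr : 5 ≤ r) (hk : k = r * (100 * (r + 1) + 1))
    (hl : l = 99 * (r + 1) + 1) :
    Real.log ((8 * (r : ℝ) ^ r) ^ (2 * l) * (24 * (k : ℝ) ^ 2) ^ r) ≤ 300 * ((r : ℝ) + 1) ^ 3 := by
  have hr' : (5 : ℝ) ≤ r := by exact_mod_cast hr
  have hk1 : (1 : ℝ) ≤ k := by
    have : 1 ≤ k := by rw [hk]; exact Nat.mul_pos (by omega) (by omega)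
    exact_mod_cast this
  have hl' : (l : ℝ) ≤ 100 * (r + 1) := by
    have : l ≤ 100 * (r + 1) := by omega
    exact_mod_cast this
  have hlog2 := Real.log_two_lt_d9
  have hlog20 := Real.log_two_gt_d9
  have hlogr : Real.log r ≤ r := (Real.log_le_sub_one_of_pos (by linarith)).trans (by linarith)
  have hlogr1 : Real.log ((r : ℝ) + 1) ≤ r :=
    (Real.log_le_sub_one_of_pos (by linarith)).trans (by linarith)
  have h8 : Real.log 8 = 3 * Real.log 2 := by
    rw [show (8 : ℝ) = 2 ^ 3 by norm_num, Real.log_pow]; norm_num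
  have hk2 : 24 * (k : ℝ) ^ 2 ≤ 2 ^ 18 * ((r : ℝ) + 1) ^ 4 := by
    have : (k : ℝ) ≤ 101 * ((r : ℝ) + 1) ^ 2 := by
      rw [hk]; push_cast; nlinarith
    calc 24 * (k : ℝ) ^ 2 ≤ 24 * (101 * ((r : ℝ) + 1) ^ 2) ^ 2 := by gcongr
      _ ≤ _ := by nlinarith [pow_pos (by linarith : (0 : ℝ) < (r : ℝ) + 1) 4]
  have h24 : Real.log (24 * (k : ℝ) ^ 2) ≤ 13 + 4 * r := by
    calc Real.log (24 * (k : ℝ) ^ 2) ≤ Real.log (2 ^ 18 * ((r : ℝ) + 1) ^ 4) :=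
          Real.log_le_log (by positivity) hk2
      _ = 18 * Real.log 2 + 4 * Real.log ((r : ℝ) + 1) := by
          rw [Real.log_mul (by positivity) (by positivity), Real.log_pow, Real.log_pow]; norm_num
      _ ≤ _ := by linarith
  rw [Real.log_mul (by positivity) (by positivity), Real.log_pow, Real.log_pow,
    Real.log_mul (by norm_num) (by positivity), Real.log_pow, h8]
  push_cast
  have a1 : (3 * Real.log 2 + r * Real.log r) ≤ 3 + (r : ℝ) * r := by
    have := mul_le_mul_of_nonneg_left hlogr (by linarith : (0 : ℝ) ≤ r)
    linarith
  have a0 : 0 ≤ 3 + (r : ℝ) * r := by positivity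
  calc 2 * (l : ℝ) * (3 * Real.log 2 + r * Real.log r) + r * Real.log (24 * (k : ℝ) ^ 2)
      ≤ 2 * (100 * ((r : ℝ) + 1)) * (3 + (r : ℝ) * r) + r * (13 + 4 * r) := by gcongr
    _ ≤ _ := by nlinarith [pow_pos (by linarith : (0 : ℝ) < r) 3]

/-- For exponents `e = j + 1` in the window, an order `Qj` between `q / D ^ e` and `q ^ (1 - e / R)`
allows a saving of `exp (R ℓ / 20)` in the corresponding coordinate. -/
theorem window_bounds {q D r j P Qj : ℕ} {ℓ lq : ℝ} (hw : InWindow r j) (hjr : j < r) (hq : 1 ≤ q)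
    (hD1 : 1 ≤ D) (hP1 : 1 ≤ P) (hQj : 1 ≤ Qj) (hlq : Real.log q = lq) (hℓ0 : 0 < ℓ)
    (h1 : 3 * lq ≤ (r + 1) * ℓ) (h2 : 2 * (r + 1) * ℓ ≤ 7 * lq)
    (hD : Real.log D ≤ ℓ / 15 + lq / (r + 1)) (hP : 28 * ℓ ≤ 100 * Real.log P)
    (hQ1 : q ≤ Qj * D ^ (j + 1)) (hQ2 : Qj ^ (r + 1) ≤ q ^ (r - j)) :
    Real.exp ((r + 1) * ℓ / 20) ≤ Qj ∧
      Qj * Real.exp ((r + 1) * ℓ / 20) ≤ ((P : ℝ) ^ (j + 1)) ^ 2 := by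
  obtain ⟨hw1, hw2⟩ := hw
  have hq0 : (0 : ℝ) < q := by exact_mod_cast hq
  have hDpos : (0 : ℝ) < D := by exact_mod_cast hD1
  have hPpos : (0 : ℝ) < P := by exact_mod_cast hP1
  have hQpos : (0 : ℝ) < Qj := by exact_mod_cast hQj
  have hr0 : (0 : ℝ) ≤ r := Nat.cast_nonneg r
  set e : ℝ := (j : ℝ) + 1 with he
  have he1 : (r : ℝ) + 1 ≤ 2 * e := by rw [he]; exact_mod_cast hw1
  have he2 : 3 * e ≤ 2 * ((r : ℝ) + 1) := by rw [he]; exact_mod_cast hw2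
  have hl1 : lq ≤ Real.log (Qj) + e * Real.log D := by
    have h : (q : ℝ) ≤ Qj * (D : ℝ) ^ (j + 1) := by exact_mod_cast hQ1
    have := Real.log_le_log hq0 h
    rw [Real.log_mul hQpos.ne' (by positivity), Real.log_pow, hlq] at this
    push_cast at this
    exact this
  have hl2 : (r + 1) * Real.log (Qj) ≤ (r + 1 - e) * lq := by
    have h : (Qj : ℝ) ^ (r + 1) ≤ (q : ℝ) ^ (r - j) := by exact_mod_cast hQ2
    have := Real.log_le_log (by positivity) h
    rw [Real.log_pow, Real.log_pow, hlq, Nat.cast_sub hjr.le] at this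
    push_cast at this
    rw [he]
    linarith
  have hlq0 : 0 ≤ lq := by rw [← hlq]; exact Real.log_natCast_nonneg q
  have hRpos : (0 : ℝ) < (r : ℝ) + 1 := by linarith
  have hmul : e * (lq / (r + 1)) ≤ 2 / 3 * lq := by
    rw [mul_div_assoc', div_le_iff₀ hRpos]
    nlinarith
  have hb1 : (r + 1) * ℓ / 20 ≤ Real.log (Qj) := by
    have h3 : e * Real.log D ≤ e * (ℓ / 15 + lq / (r + 1)) := by
      gcongr
    have h4 : e * (ℓ / 15) ≤ 2 / 45 * ((r + 1) * ℓ) := by nlinarith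
    rw [mul_add] at h3
    nlinarith
  have hb2 : Real.log (Qj) ≤ lq / 2 := by
    refine le_of_mul_le_mul_left (hl2.trans ?_) hRpos
    nlinarith
  constructor
  · rw [← Real.exp_log hQpos]
    exact Real.exp_le_exp.mpr hb1
  · have hb3 : Real.log (Qj) + (r + 1) * ℓ / 20 ≤ 2 * (e * Real.log P) := by
      have : (r + 1) * (28 * ℓ) ≤ 2 * e * (100 * Real.log P) := by
        gcongr
      nlinarith
    calc (Qj : ℝ) * Real.exp ((r + 1) * ℓ / 20) = Real.exp (Real.log (Qj) + (r + 1) * ℓ / 20) := by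
          rw [Real.exp_add, Real.exp_log hQpos]
      _ ≤ Real.exp (2 * (e * Real.log P)) := Real.exp_le_exp.mpr hb3
      _ = ((P : ℝ) ^ (j + 1)) ^ 2 := by
          rw [← Real.exp_log (pow_pos (pow_pos hPpos _) 2), Real.log_pow, Real.log_pow, he]
          push_cast; rfl
/-- The bound for the bilinear sums at the chosen parameters, where `ℓ` and `lq` stand for the
logarithms of the length of the sum and of the modulus. -/
theorem polyBilinearSum_le_exp {q D r p k : ℕ} {ℓ lq : ℝ} (hr : 5 ≤ r) (hq : 1 ≤ q) (hD1 : 1 ≤ D)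
    (hp : p.Prime) (hlq : Real.log q = lq) (hℓ : 5 * 10 ^ 7 * ((r : ℝ) + 1) ^ 2 ≤ ℓ)
    (h1 : 3 * lq ≤ (r + 1) * ℓ) (h2 : 2 * (r + 1) * ℓ ≤ 7 * lq)
    (hD : Real.log D ≤ ℓ / 15 + lq / (r + 1))
    (hp1 : 28 * ℓ ≤ 100 * (100 * (r + 1) * Real.log p))
    (hp2 : 100 * (100 * (r + 1) * Real.log p) ≤ 29 * ℓ) (hk : k = r * (100 * (r + 1) + 1))
    (ζ : Fin r → ℂ) (Q : Fin r → ℕ) (hQ : ∀ j, 1 ≤ Q j) (hζ : ∀ j, IsPrimitiveRoot (ζ j) (Q j))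
    (hQD : ∀ j : Fin r, 1 ≤ (j : ℕ) → q ≤ Q j * D ^ ((j : ℕ) + 1) ∧ Q j ^ (r + 1) ≤ q ^ (r - j)) :
    ‖polyBilinearSum ζ (p ^ (100 * (r + 1)))‖ ≤ ((p ^ (100 * (r + 1)) : ℕ) : ℝ) ^ 2 *
      Real.exp (-(4 / 1000 * ((r : ℝ) + 1) ^ 2 * ℓ) / (2 * k * (2 * k) : ℕ)) := by
  have hr' : (5 : ℝ) ≤ r := by exact_mod_cast hr
  have hℓ0 : 0 < ℓ := lt_of_lt_of_le (by positivity) hℓ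
  have hp0 : (0 : ℝ) < p := by exact_mod_cast hp.pos
  have hq0 : (0 : ℝ) < q := by exact_mod_cast hq
  have hDpos : (0 : ℝ) < D := by exact_mod_cast hD1
  have hk1 : 1 ≤ k := by rw [hk]; exact Nat.mul_pos (by omega) (by omega)
  have hk1' : (1 : ℝ) ≤ k := by exact_mod_cast hk1
  set P := p ^ (100 * (r + 1)) with hP
  have hP1 : 1 ≤ P := pow_pos hp.pos _
  have hPpos : (0 : ℝ) < P := by exact_mod_cast hP1
  have hlogP : Real.log P = 100 * (r + 1) * Real.log p := by
    rw [hP, Nat.cast_pow, Real.log_pow]; push_cast; ring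
  -- the prime is large in terms of the degree
  have hpr : (4 * r) ^ 5 ≤ p := by
    have hlogp : 10 ^ 5 * ((r : ℝ) + 1) ≤ Real.log p := by
      have : (0 : ℝ) < (r : ℝ) + 1 := by linarith
      refine le_of_mul_le_mul_left ?_ this
      nlinarith
    have : ((4 * r : ℝ)) ^ 5 ≤ p := by
      rw [← Real.exp_log hp0]
      calc (4 * r : ℝ) ^ 5 ≤ Real.exp (4 * r) ^ 5 := by
            gcongr
            linarith [Real.add_one_le_exp (4 * r : ℝ)]
        _ = Real.exp (20 * r) := by rw [← Real.exp_nat_mul]; congr 1; push_cast; ring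
        _ ≤ _ := Real.exp_le_exp.mpr (by linarith)
    exact_mod_cast this
  set G : Fin r → ℝ := fun j => if InWindow r j then Real.exp ((r + 1) * ℓ / 20) else 1 with hG
  have hGpos : ∀ j, 0 < G j := fun j => by
    simp only [hG]; split_ifs <;> positivity
  have hGQ : ∀ j, G j = 1 ∨
      (G j ≤ Q j ∧ Q j * G j ≤ ((k : ℝ) * (P : ℝ) ^ ((j : ℕ) + 1)) ^ 2) := by
    intro j
    by_cases hw : InWindow r j
    swap
    · left; simp [hG, hw]
    right
    have hGj : G j = Real.exp ((r + 1) * ℓ / 20) := if_pos hw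
    obtain ⟨hQ1, hQ2⟩ := hQD j (by have := hw.1; omega)
    obtain ⟨hb1, hb2⟩ := window_bounds hw j.2 hq hD1 hP1 (hQ j) hlq hℓ0 h1 h2 hD
      (by rw [hlogP]; exact hp1) hQ1 hQ2
    rw [hGj]
    refine ⟨hb1, hb2.trans ?_⟩
    gcongr
    exact le_mul_of_one_le_left (by positivity) hk1'
  have hmain := polyBilinearSum_prime_bound (l := 99 * (r + 1) + 1) hp (by omega) hpr ζ Q hQ hζ G
    hGpos (k := k) (P := P) (by rw [hk]; ring) (by rw [hP]; congr 1; ring) hGQ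
  -- at least a seventh of the `R` exponents is in the window, and each saves `R ℓ / 20`
  have hprodG : Real.exp (((r : ℝ) + 1) ^ 2 * ℓ / 140) ≤ ∏ j, G j := by
    have hcard := le_seven_mul_card_window hr
    have hcard' : (r : ℝ) + 1 ≤ 7 * #{j : Fin r | InWindow r j} := by exact_mod_cast hcard
    simp only [hG]
    rw [prod_ite, prod_const, prod_const_one, mul_one, ← Real.exp_nat_mul]
    refine Real.exp_le_exp.mpr ?_
    have : 0 ≤ (r + 1) * ℓ := by positivity
    nlinarith
  have hlogC := log_consts_le (l := 99 * (r + 1) + 1) hr hk rfl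
  have hC : (8 * (r : ℝ) ^ r) ^ (2 * (99 * (r + 1) + 1)) * (p : ℝ) ^ (r * (r * (r + 1))) *
      (24 * (k : ℝ) ^ 2) ^ r ≤ Real.exp (3 / 1000 * ((r : ℝ) + 1) ^ 2 * ℓ) := by
    have e1 : (8 * (r : ℝ) ^ r) ^ (2 * (99 * (r + 1) + 1)) * (p : ℝ) ^ (r * (r * (r + 1))) *
        (24 * (k : ℝ) ^ 2) ^ r = Real.exp (Real.log ((8 * (r : ℝ) ^ r) ^ (2 * (99 * (r + 1) + 1)) *
          (24 * (k : ℝ) ^ 2) ^ r) + (r * (r * (r + 1)) : ℕ) * Real.log p) := by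
      rw [Real.exp_add, Real.exp_log (by positivity), Real.exp_nat_mul, Real.exp_log hp0]
      ring
    rw [e1]
    refine Real.exp_le_exp.mpr ?_
    have e2 : ((r * (r * (r + 1)) : ℕ) : ℝ) * Real.log p ≤ (r : ℝ) ^ 2 * (29 / 10000 * ℓ) := by
      push_cast
      have h : (r + 1) * Real.log p ≤ 29 / 10000 * ℓ := by linarith
      calc (r : ℝ) * (r * (r + 1)) * Real.log p = (r : ℝ) ^ 2 * ((r + 1) * Real.log p) := by ring
        _ ≤ _ := by gcongr
    have e3 : (r : ℝ) ^ 2 * (29 / 10000 * ℓ) ≤ ((r : ℝ) + 1) ^ 2 * (29 / 10000 * ℓ) := by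
      gcongr; linarith
    have e4 : 300 * ((r : ℝ) + 1) ^ 3 ≤ ((r : ℝ) + 1) ^ 2 * (1 / 10000 * ℓ) := by
      have : 300 * ((r : ℝ) + 1) ≤ 1 / 10000 * ℓ := by nlinarith
      nlinarith [sq_nonneg ((r : ℝ) + 1)]
    linarith
  set K := 2 * k * (2 * k) with hK
  have hK0 : K ≠ 0 := by rw [hK]; positivity
  have hfin : ‖polyBilinearSum ζ P‖ ^ K ≤ ((P : ℝ) ^ 2 *
      Real.exp (-(4 / 1000 * ((r : ℝ) + 1) ^ 2 * ℓ) / K)) ^ K := by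
    have e1 : ((P : ℝ) ^ 2 * Real.exp (-(4 / 1000 * ((r : ℝ) + 1) ^ 2 * ℓ) / K)) ^ K
        = (P : ℝ) ^ (2 * K) * Real.exp (-(4 / 1000 * ((r : ℝ) + 1) ^ 2 * ℓ)) := by
      rw [mul_pow, ← pow_mul, ← Real.exp_nat_mul, mul_div_cancel₀]
      exact_mod_cast hK0
    rw [e1]
    refine le_of_mul_le_mul_right ?_ (Real.exp_pos (((r : ℝ) + 1) ^ 2 * ℓ / 140))
    calc _ ≤ ‖polyBilinearSum ζ P‖ ^ K * ∏ j, G j := by gcongr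
      _ ≤ (P : ℝ) ^ (2 * K) * Real.exp (3 / 1000 * ((r : ℝ) + 1) ^ 2 * ℓ) :=
          hmain.trans (by gcongr)
      _ ≤ (P : ℝ) ^ (2 * K) * Real.exp (-(4 / 1000 * ((r : ℝ) + 1) ^ 2 * ℓ) +
            ((r : ℝ) + 1) ^ 2 * ℓ / 140) := by
          gcongr
          have : 0 ≤ ((r : ℝ) + 1) ^ 2 * ℓ := by positivity
          linarith
      _ = _ := by rw [Real.exp_add]; ring
  exact (pow_le_pow_iff_left₀ (norm_nonneg _) (by positivity) hK0).mp hfin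

/-- A prime of prescribed logarithmic size. -/
theorem exists_prime_log_mem {x : ℝ} (hx : 0 ≤ x) :
    ∃ p : ℕ, p.Prime ∧ x ≤ Real.log p ∧ Real.log p ≤ x + 1.4 := by
  have hy1 : 1 ≤ Real.exp x := Real.one_le_exp hx
  obtain ⟨p, hp, h1, h2⟩ := Nat.exists_prime_lt_and_le_two_mul ⌈Real.exp x⌉₊
    (by have := Nat.ceil_pos.mpr (Real.exp_pos x); omega)
  have hp0 : (0 : ℝ) < p := by exact_mod_cast hp.pos
  refine ⟨p, hp, (Real.le_log_iff_exp_le hp0).mpr ?_, (Real.log_le_iff_le_exp hp0).mpr ?_⟩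
  · exact (Nat.le_ceil _).trans (by exact_mod_cast h1.le)
  · have h3 : (p : ℝ) ≤ 2 * ⌈Real.exp x⌉₊ := by exact_mod_cast h2
    have h4 := (Nat.ceil_lt_add_one (Real.exp_pos x).le).le
    have h5 : (4 : ℝ) ≤ Real.exp 1.4 := by
      rw [← Real.log_le_iff_le_exp (by norm_num), show (4 : ℝ) = 2 ^ 2 by norm_num, Real.log_pow]
      have := Real.log_two_lt_d9
      norm_num; linarith
    calc (p : ℝ) ≤ Real.exp x * 4 := by linarith
      _ ≤ Real.exp x * Real.exp 1.4 := by gcongr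
      _ = _ := (Real.exp_add _ _).symm

/-- The degree parameter `R ≈ 3 log q / log N`, here with `R = r + 1`. -/
theorem exists_degree {ℓ lq : ℝ} (hℓ : 0 < ℓ) (h2 : 2 * ℓ ≤ lq) (h3 : 900 ^ 3 * lq ^ 2 ≤ ℓ ^ 3) :
    ∃ r : ℕ, 5 ≤ r ∧ 3 * lq ≤ (r + 1) * ℓ ∧ 2 * (r + 1) * ℓ ≤ 7 * lq ∧ r * ℓ ≤ 3 * lq ∧
      5 * 10 ^ 7 * ((r : ℝ) + 1) ^ 2 ≤ ℓ := by
  set ρ := lq / ℓ with hρ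
  have hlq : lq = ρ * ℓ := by rw [hρ, div_mul_cancel₀ _ hℓ.ne']
  have hρ2 : 2 ≤ ρ := by rw [hρ, le_div_iff₀ hℓ]; exact h2
  have hc1 := Nat.le_ceil (3 * ρ)
  have hc2 := Nat.ceil_lt_add_one (by linarith : 0 ≤ 3 * ρ)
  have hc6 : 6 ≤ ⌈3 * ρ⌉₊ := by
    have : ((6 : ℕ) : ℝ) ≤ ⌈3 * ρ⌉₊ := by push_cast; linarith
    exact_mod_cast this
  obtain ⟨r, hr⟩ := Nat.exists_eq_add_of_le' (show 1 ≤ ⌈3 * ρ⌉₊ by omega)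
  rw [hr] at hc1 hc2
  push_cast at hc1 hc2
  have hρℓ : 900 ^ 3 * ρ ^ 2 ≤ ℓ := by
    rw [hlq] at h3
    have : 0 < ℓ ^ 2 := by positivity
    refine le_of_mul_le_mul_right ?_ this
    linarith
  -- rounding up costs at most a factor `7 / 6`, as `3 ρ ≥ 6`
  have hr7 : (r : ℝ) + 1 ≤ 7 / 2 * ρ := by linarith
  refine ⟨r, by omega, ?_, ?_, ?_, ?_⟩
  · rw [hlq]; nlinarith
  · rw [hlq]; nlinarith
  · rw [hlq]; nlinarith
  · have : ((r : ℝ) + 1) ^ 2 ≤ (7 / 2 * ρ) ^ 2 := by gcongr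
    nlinarith

/-- Numerical comparison of the saving in the bilinear sums with the required one. -/
theorem saving_le {r k : ℕ} {ℓ lq : ℝ} (hr : 5 ≤ r) (hℓ : 0 < ℓ) (hlq : 0 < lq)
    (h : r * ℓ ≤ 3 * lq) (hk : k = r * (100 * (r + 1) + 1)) :
    2 * (1 / 160 ^ 4 * (ℓ ^ 3 / lq ^ 2)) ≤
      (4 / 1000 * ((r : ℝ) + 1) ^ 2 * ℓ) / (2 * k * (2 * k) : ℕ) := by
  have hr0 : (5 : ℝ) ≤ r := by exact_mod_cast hr
  have hk1 : (0 : ℝ) < k := by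
    have : 0 < k := by rw [hk]; exact Nat.mul_pos (by omega) (by omega)
    exact_mod_cast this
  have hkle : (k : ℝ) ≤ 101 * (r * ((r : ℝ) + 1)) := by rw [hk]; push_cast; nlinarith
  have h9 : ((r : ℝ) * ℓ) ^ 2 ≤ (3 * lq) ^ 2 := by gcongr
  have hK : ((2 * k * (2 * k) : ℕ) : ℝ) = 4 * (k : ℝ) ^ 2 := by push_cast; ring
  rw [hK, le_div_iff₀ (by positivity)]
  have h10 : (k : ℝ) ^ 2 ≤ (101 * (r * ((r : ℝ) + 1))) ^ 2 := by gcongr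
  have h11 : ℓ ^ 3 / lq ^ 2 * (r : ℝ) ^ 2 ≤ 9 * ℓ := by
    rw [div_mul_eq_mul_div, div_le_iff₀ (by positivity)]
    nlinarith
  have h0 : 0 ≤ ℓ ^ 3 / lq ^ 2 := by positivity
  calc 2 * (1 / 160 ^ 4 * (ℓ ^ 3 / lq ^ 2)) * (4 * (k : ℝ) ^ 2)
      ≤ 2 * (1 / 160 ^ 4 * (ℓ ^ 3 / lq ^ 2)) * (4 * (101 * (r * ((r : ℝ) + 1))) ^ 2) := by gcongr
    _ = 8 * 101 ^ 2 / 160 ^ 4 * ((r : ℝ) + 1) ^ 2 * (ℓ ^ 3 / lq ^ 2 * (r : ℝ) ^ 2) := by ring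
    _ ≤ 8 * 101 ^ 2 / 160 ^ 4 * ((r : ℝ) + 1) ^ 2 * (9 * ℓ) := by gcongr
    _ ≤ _ := by
        have : 0 ≤ ((r : ℝ) + 1) ^ 2 * ℓ := by positivity
        nlinarith

theorem exists_prime_in_range {r : ℕ} {ℓ : ℝ} (hr : 1 ≤ r)
    (hℓ : 5 * 10 ^ 7 * ((r : ℝ) + 1) ^ 2 ≤ ℓ) :
    ∃ p : ℕ, p.Prime ∧ 28 * ℓ ≤ 100 * (100 * (r + 1) * Real.log p) ∧
      100 * (100 * (r + 1) * Real.log p) ≤ 29 * ℓ := by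
  have hr0 : (1 : ℝ) ≤ r := by exact_mod_cast hr
  set x := 28 * ℓ / (10000 * ((r : ℝ) + 1)) with hx
  have hℓ0 : 0 < ℓ := lt_of_lt_of_le (by positivity) hℓ
  have hmul : 10000 * ((r : ℝ) + 1) * x = 28 * ℓ := by rw [hx]; field_simp
  obtain ⟨p, hp, hp1, hp2⟩ := exists_prime_log_mem (x := x) (by positivity)
  refine ⟨p, hp, ?_, ?_⟩
  · have : 10000 * ((r : ℝ) + 1) * x ≤ 10000 * ((r : ℝ) + 1) * Real.log p := by gcongr
    linarith
  · have : 10000 * ((r : ℝ) + 1) * Real.log p ≤ 10000 * ((r : ℝ) + 1) * (x + 1.4) := by gcongr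
    nlinarith

/-- The main term and the boundary term of the shifts together stay below the required bound. -/
theorem exp_comparison {ℓ v τ X : ℝ} (hvτ : 2 * v ≤ τ) (hv1 : 1 ≤ v) (hv2 : v ≤ ℓ / 1000)
    (hDP : X ≤ Real.exp (98 / 100 * ℓ)) :
    Real.exp ℓ * Real.exp (-τ) + 2 * X < Real.exp ℓ * Real.exp (-v) := by
  have hexp4 : (4 : ℝ) ≤ Real.exp (19 / 1000 * ℓ) := by
    linarith [Real.add_one_le_exp (19 / 1000 * ℓ)]
  have hshift : 4 * X ≤ Real.exp ℓ * Real.exp (-v) := by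
    calc 4 * X ≤ 4 * Real.exp (98 / 100 * ℓ) := by gcongr
      _ ≤ Real.exp (19 / 1000 * ℓ) * Real.exp (98 / 100 * ℓ) := by gcongr
      _ = Real.exp (19 / 1000 * ℓ + 98 / 100 * ℓ) := (Real.exp_add _ _).symm
      _ ≤ Real.exp (ℓ + -v) := Real.exp_le_exp.mpr (by linarith)
      _ = Real.exp ℓ * Real.exp (-v) := Real.exp_add _ _
  have hmain : Real.exp (-τ) ≤ Real.exp (-v) * (2 / 5) := by
    calc Real.exp (-τ) ≤ Real.exp (-v + -1) := Real.exp_le_exp.mpr (by linarith)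
      _ = Real.exp (-v) * Real.exp (-1) := Real.exp_add _ _
      _ ≤ _ := by
        gcongr
        have := Real.exp_neg_one_lt_d9
        linarith
  have hpos : 0 < Real.exp ℓ * Real.exp (-v) := by positivity
  have hmain' : Real.exp ℓ * Real.exp (-τ) ≤ Real.exp ℓ * (Real.exp (-v) * (2 / 5)) := by gcongr
  linarith

theorem theorem1 :
    ∃ q₀ : ℕ, ∀ q : ℕ, q₀ ≤ q → ∀ N : ℕ,
      max ((kernel q : ℝ) ^ 15) (Real.exp (900 * (Real.log (q : ℝ)) ^ ((2 : ℝ) / 3))) ≤ (N : ℝ) →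
      (N : ℝ) ≤ Real.sqrt (q : ℝ) →
      ∀ a b c : ℤ, Int.gcd a (q : ℤ) = 1 →
        ‖kloostermanSum q N a b c‖ <
          (N : ℝ) * Real.exp (-((1 / 160 ^ 4 : ℝ) *
            ((Real.log (N : ℝ)) ^ 3 / (Real.log (q : ℝ)) ^ 2))) := by
  refine ⟨2, fun q hq N hN1 hN2 a b c ha => ?_⟩
  obtain ⟨hNd, hNe⟩ := max_le_iff.mp hN1
  have hN0 : (0 : ℝ) < N := (Real.exp_pos _).trans_le hNe
  have hq0 : (0 : ℝ) < q := by exact_mod_cast (by omega : 0 < q)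
  set ℓ := Real.log N with hℓ
  set lq := Real.log q with hlq
  have hlq0 : 0 < lq := Real.log_pos (by exact_mod_cast hq)
  have hexpN : Real.exp ℓ = N := Real.exp_log hN0
  have hℓ1 : 900 * lq ^ ((2 : ℝ) / 3) ≤ ℓ := (Real.le_log_iff_exp_le hN0).mpr hNe
  have hℓ0 : 0 < ℓ := lt_of_lt_of_le (by positivity) hℓ1
  have hℓ2 : 2 * ℓ ≤ lq := by
    have := Real.log_le_log hN0 hN2
    rw [Real.log_sqrt hq0.le] at this
    linarith
  have hℓ3 : 900 ^ 3 * lq ^ 2 ≤ ℓ ^ 3 := by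
    have h : (lq ^ ((2 : ℝ) / 3)) ^ 3 = lq ^ 2 := by
      rw [← Real.rpow_natCast, ← Real.rpow_mul hlq0.le, ← Real.rpow_natCast]
      norm_num
    calc 900 ^ 3 * lq ^ 2 = (900 * lq ^ ((2 : ℝ) / 3)) ^ 3 := by rw [mul_pow, h]
      _ ≤ ℓ ^ 3 := by gcongr
  obtain ⟨r, hr, hr1, hr2, hr3, hr4⟩ := exists_degree hℓ0 hℓ2 hℓ3
  have hr0 : (5 : ℝ) ≤ r := by exact_mod_cast hr
  have hRpos : (0 : ℝ) < (r : ℝ) + 1 := by linarith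
  obtain ⟨D, hD1, hDq, hDle⟩ := exists_root_modulus (q := q) (R := r + 1) (by omega) (by omega)
  have hDpos : (0 : ℝ) < D := by exact_mod_cast hD1
  have hker : (0 : ℝ) < kernel q := by
    have : 0 < kernel q := prod_pos fun p hp => (Nat.prime_of_mem_primeFactors hp).pos
    exact_mod_cast this
  have hlogD : Real.log D ≤ ℓ / 15 + lq / (r + 1) := by
    have h1 : 15 * Real.log (kernel q) ≤ ℓ := by
      have := Real.log_le_log (by positivity) hNd
      rw [Real.log_pow] at this
      exact_mod_cast this
    have h2 : (D : ℝ) ^ (r + 1) ≤ (kernel q : ℝ) ^ (r + 1) * q := by exact_mod_cast hDle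
    have h3 := Real.log_le_log (by positivity) h2
    rw [Real.log_mul (by positivity) hq0.ne', Real.log_pow, Real.log_pow] at h3
    push_cast at h3
    refine le_of_mul_le_mul_left (h3.trans ?_) hRpos
    rw [mul_add, mul_div_cancel₀ _ hRpos.ne']
    nlinarith
  obtain ⟨p, hp, hp1, hp2⟩ := exists_prime_in_range (by omega : 1 ≤ r) hr4
  set k := r * (100 * (r + 1) + 1) with hk
  set P := p ^ (100 * (r + 1)) with hP
  have hPpos : (0 : ℝ) < P := by exact_mod_cast pow_pos hp.pos _
  have hlogP : 100 * Real.log P ≤ 29 * ℓ := by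
    rw [hP, Nat.cast_pow, Real.log_pow]
    push_cast
    linarith
  set τ := (4 / 1000 * ((r : ℝ) + 1) ^ 2 * ℓ) / (2 * k * (2 * k) : ℕ) with hτ
  have hred := kloostermanSum_le_of_bilinear (by omega : q ≠ 0) (by omega : 1 ≤ r) hD1 hDq ha b c N P
    ((P : ℝ) ^ 2 * Real.exp (-τ)) (by positivity) fun ζ Q hQ hζ hQD => by
      have := polyBilinearSum_le_exp hr (by omega) hD1 hp hlq.symm hr4 hr1 hr2 hlogD hp1 hp2 hk
        ζ Q hQ hζ hQD
      rwa [neg_div] at this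
  have hS : ‖kloostermanSum q N a b c‖ ≤ N * Real.exp (-τ) + 2 * D * (P : ℝ) ^ 2 := by
    have hP2 : (0 : ℝ) < (P : ℝ) ^ 2 := by positivity
    refine le_of_mul_le_mul_left (hred.trans_eq ?_) hP2
    ring
  set v := (1 / 160 ^ 4 : ℝ) * (ℓ ^ 3 / lq ^ 2) with hv
  have hvτ : 2 * v ≤ τ := saving_le hr hℓ0 hlq0 hr3 hk
  have hv1 : 1 ≤ v := by
    have : (900 : ℝ) ^ 3 ≤ ℓ ^ 3 / lq ^ 2 := by rwa [le_div_iff₀ (by positivity)]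
    rw [hv]
    norm_num at this ⊢
    linarith
  have hv2 : v ≤ ℓ / 1000 := by
    have : ℓ ^ 3 / lq ^ 2 ≤ ℓ := by
      rw [div_le_iff₀ (by positivity)]
      have : ℓ ^ 2 ≤ lq ^ 2 := by gcongr; linarith
      nlinarith
    rw [hv]
    linarith
  have hDP : D * (P : ℝ) ^ 2 ≤ Real.exp (98 / 100 * ℓ) := by
    have h1 : lq / (r + 1) ≤ ℓ / 3 := by
      rw [div_le_iff₀ hRpos]; linarith
    rw [← Real.log_le_iff_le_exp (by positivity), Real.log_mul hDpos.ne' (by positivity),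
      Real.log_pow]
    push_cast
    linarith
  have := exp_comparison hvτ hv1 hv2 hDP
  rw [hexpN] at this
  linarith
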